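/- Let $E$ be a Hausdorff, sequentially complete, barreled locally convex space over $\mathbb{C}$, let $L(E)$ be the space of continuous linear operators on $E$ (with the topology of uniform convergence on bounded sets), let $C\in L(E)$ (not necessarily injective), and let $\alpha\ge 0$. Put $g_\beta(t)=t^{\beta-1}/\Gamma(\beta)$ and write $\mathcal{D}=C_c^\infty(\mathbb{R})$, $\mathcal{D}_0=\{\varphi\in\mathcal{D}:\operatorname{supp}\varphi\subseteq[0,\infty)\}$. Let $(S_\alpha(t))_{t\ge 0}\subseteq L(E)$ be an $\alpha$-times integrated $C$-semigroup: it is strongly continuous, $S_\alpha(t)C=CS_\alpha(t)$ for $t\ge0$, and for all $t,s\ge 0$, $x\in E$, $$S_\alpha(t)S_\alpha(s)x=\Bigl[\int_0^{t+s}-\int_0^t-\int_0^s\Bigr]g_\alpha(t+s-r)S_\alpha(r)Cx\,dr\quad(\alpha>0),\qquad S_0(t)S_0(s)x=S_0(t+s)Cx\quad(\alpha=0).$$ Assume that it is exponentially equicontinuous, i.e. for some $\omega\in\mathbb{R}$ the family $\{e^{-\omega t}S_\alpha(t):t\ge 0\}$ is equicontinuous, and let $\mathcal{A}$ be its integral generator,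 the multivalued linear operator with graph $$\mathcal{A}=\Bigl\{(x,y)\in E\times E:\ S_\alpha(t)x-g_{\alpha+1}(t)Cx=\int_0^tS_\alpha(s)y\,ds\ \text{ for all } t\ge 0\Bigr\}.$$ For $\varphi\in\mathcal{D}$ let $W^\alpha_+\varphi$ be the Weyl fractional derivative: with $n=\lceil\alpha\rceil$, $W^\alpha_+\varphi=(-1)^n\varphi^{(n)}$ if $\alpha=n$, and otherwise $$W^\alpha_+\varphi(t)=\frac{(-1)^n}{\Gamma(n-\alpha)}\frac{d^n}{dt^n}\int_t^\infty(s-t)^{n-\alpha-1}\varphi(s)\,ds .$$ Then the formula $$\mathcal{G}(\varphi)x=\int_0^\infty W^\alpha_+\varphi(t)\,S_\alpha(t)x\,dt,\qquad \varphi\in\mathcal{D},\ x\in E,$$ defines an $L(E)$-valued distribution $\mathcal{G}$ (a continuous linear map $\mathcal{D}\to L(E)$) which is an exponential pre-$(C\text{-DS})$, that is: 1. $\mathcal{G}$ is supported in $[0,\infty)$, $C\mathcal{G}(\varphi)=\mathcal{G}(\varphi)C$ for all $\varphi\in\mathcal{D}$, and $\mathcal{G}(\varphi*_0\psi)C=\mathcal{G}(\varphi)\mathcal{G}(\psi)$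 for all $\varphi,\psi\in\mathcal{D}$, where $(\varphi*_0\psi)(t)=\int_0^t\varphi(t-s)\psi(s)\,ds$; 2. there is $\omega\in\mathbb{R}$ such that the distribution $e^{-\omega t}\mathcal{G}:\varphi\mapsto\mathcal{G}(e^{-\omega\cdot}\varphi)$ is tempered, i.e. extends to a continuous linear map $\mathcal{S}(\mathbb{R})\to L(E)$. Moreover, the integral generator of $\mathcal{G}$, i.e. the multivalued linear operator with graph $$\bigl\{(x,y)\in E\times E:\ \mathcal{G}(-\varphi')x=\mathcal{G}(\varphi)y\ \text{ for all }\varphi\in\mathcal{D}_0\bigr\},$$ contains $\mathcal{A}$. -/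

import Mathlib

open Set Filter Topology MeasureTheory TopologicalSpace
open scoped Distributions SchwartzMap ContDiff LineDeriv

noncomputable section

namespace CDS

/-! ### Test functions on the line -/

/-- The space `𝓓 = C_c^∞(ℝ)` of complex test functions, with its usual locally convex topology. -/
abbrev TestFn : Type := 𝓓((⊤ : Opens ℝ), ℂ)

theorem contDiff_integral_nat (n : ℕ) :
    ∀ g : ℝ × ℝ → ℂ, ContDiff ℝ ∞ g →
      ContDiff ℝ n (fun t : ℝ => ∫ u in (0 : ℝ)..1, g (t, u)) := by
  have key : ∀ g : ℝ × ℝ → ℂ, ContDiff ℝ ∞ g → ∀ t₀ : ℝ,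
      HasDerivAt (fun t : ℝ => ∫ u in (0 : ℝ)..1, g (t, u))
        (∫ u in (0 : ℝ)..1, fderiv ℝ g (t₀, u) (1, 0)) t₀ := by
    intro g hg t₀
    have hg' : Continuous fun p : ℝ × ℝ => fderiv ℝ g p (1, 0) :=
      (hg.continuous_fderiv (by simp)).clm_apply continuous_const
    obtain ⟨K, hK⟩ := ((isCompact_Icc (a := t₀ - 1) (b := t₀ + 1)).prod
      (isCompact_Icc (a := (0 : ℝ)) (b := 1))).exists_bound_of_continuousOn hg'.continuousOn
    have hgc := hg.continuous
    refine (intervalIntegral.hasDerivAt_integral_of_dominated_loc_of_deriv_le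
      (F := fun t u => g (t, u)) (F' := fun t u => fderiv ℝ g (t, u) (1, 0))
      (s := Icc (t₀ - 1) (t₀ + 1)) (bound := fun _ => K)
      (Icc_mem_nhds (by linarith) (by linarith)) ?_ ?_ ?_ ?_ ?_ ?_).2
    · exact Eventually.of_forall fun t => (by fun_prop : Continuous fun u => g (t, u)).aestronglyMeasurable
    · exact (by fun_prop : Continuous fun u => g (t₀, u)).intervalIntegrable _ _
    · exact (hg'.comp (by fun_prop : Continuous fun u : ℝ => (t₀, u))).aestronglyMeasurable
    · refine Eventually.of_forall fun u hu t ht => hK (t, u) ⟨ht, ?_⟩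
      rw [uIoc_of_le zero_le_one] at hu
      exact ⟨hu.1.le, hu.2⟩
    · exact intervalIntegrable_const
    · refine Eventually.of_forall fun u _ t _ => ?_
      have h1 : HasFDerivAt g (fderiv ℝ g (t, u)) (t, u) :=
        (hg.differentiable (by simp) (t, u)).hasFDerivAt
      exact h1.comp_hasDerivAt t ((hasDerivAt_id t).prodMk (hasDerivAt_const t u))
  induction n with
  | zero =>
    intro g hg
    exact contDiff_zero.2 (continuous_iff_continuousAt.2 fun t => (key g hg t).continuousAt)
  | succ n ih =>
    intro g hg
    rw [Nat.cast_add, Nat.cast_one, contDiff_succ_iff_deriv]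
    refine ⟨fun t => (key g hg t).differentiableAt, by simp, ?_⟩
    rw [funext fun t => (key g hg t).deriv]
    exact ih (fun p => fderiv ℝ g p (1, 0))
      ((hg.fderiv_right (m := ∞) (by simp)).clm_apply contDiff_const)

theorem contDiff_convZero (φ ψ : ℝ → ℂ) (hφ : ContDiff ℝ ∞ φ) (hψ : ContDiff ℝ ∞ ψ) :
    ContDiff ℝ ∞ (fun t : ℝ => ∫ s in (0 : ℝ)..t, φ (t - s) * ψ s) := by
  have h : (fun t : ℝ => ∫ s in (0 : ℝ)..t, φ (t - s) * ψ s) =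
      fun t : ℝ => (t : ℂ) * ∫ u in (0 : ℝ)..1, φ (t - t * u) * ψ (t * u) := by
    funext t
    have := intervalIntegral.smul_integral_comp_mul_left
      (a := 0) (b := 1) (fun s => φ (t - s) * ψ s) t
    simp only [mul_zero, mul_one] at this
    rw [← this, Complex.real_smul]
  rw [h]
  refine Complex.ofRealCLM.contDiff.mul (contDiff_infty.2 fun n => ?_)
  exact contDiff_integral_nat n (fun p => φ (p.1 - p.1 * p.2) * ψ (p.1 * p.2))
    ((hφ.comp (contDiff_fst.sub (contDiff_fst.mul contDiff_snd))).mul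
      (hψ.comp (contDiff_fst.mul contDiff_snd)))

theorem hasCompactSupport_convZero (φ ψ : ℝ → ℂ) (hφ : HasCompactSupport φ)
    (hψ : HasCompactSupport ψ) :
    HasCompactSupport (fun t : ℝ => ∫ s in (0 : ℝ)..t, φ (t - s) * ψ s) := by
  obtain ⟨M, hM⟩ := hφ.isBounded.exists_norm_le
  obtain ⟨N, hN⟩ := hψ.isBounded.exists_norm_le
  refine HasCompactSupport.intro (isCompact_Icc (a := -(M + N)) (b := M + N)) fun t ht => ?_
  refine intervalIntegral.integral_zero_ae (Eventually.of_forall fun s _ => ?_)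
  by_contra h
  have h1 := hM _ (subset_tsupport φ (left_ne_zero_of_mul h))
  have h2 := hN _ (subset_tsupport ψ (right_ne_zero_of_mul h))
  rw [Real.norm_eq_abs, abs_le] at h1 h2
  exact ht ⟨by linarith, by linarith⟩

/-- The convolution product `(φ *₀ ψ)(t) = ∫_0^t φ(t - s) ψ(s) ds`, `t ∈ ℝ`. -/
def convZero (φ ψ : TestFn) : TestFn where
  toFun t := ∫ s in (0 : ℝ)..t, φ (t - s) * ψ s
  contDiff' := contDiff_convZero φ ψ φ.contDiff ψ.contDiff
  hasCompactSupport' := hasCompactSupport_convZero φ ψ φ.hasCompactSupport ψ.hasCompactSupport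
  tsupport_subset' := fun _ _ => trivial

/-- The test function `t ↦ e^{-wt} φ(t)`. -/
def expMul (w : ℝ) (φ : TestFn) : TestFn where
  toFun t := ((Real.exp (-w * t) : ℝ) : ℂ) * φ t
  contDiff' := ContDiff.mul (Complex.ofRealCLM.contDiff.comp
    (Real.contDiff_exp.comp (contDiff_const.mul contDiff_id))) φ.contDiff
  hasCompactSupport' := φ.hasCompactSupport.mul_left
  tsupport_subset' := fun _ _ => trivial

/-- A test function as an element of the Schwartz space. -/
def toSchwartz (φ : TestFn) : 𝓢(ℝ, ℂ) :=
  φ.hasCompactSupport.toSchwartzMap φ.contDiff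

/-- The Weyl fractional derivative `W^α_+ f` of order `α ≥ 0`: with `n = ⌈α⌉`, it is
`(-1)^n f^{(n)}` if `α = n`, and otherwise
`(-1)^n / Γ(n - α) · d^n/dt^n ∫_t^∞ (s - t)^{n - α - 1} f(s) ds`. -/
def weylDeriv (α : ℝ) (f : ℝ → ℂ) (t : ℝ) : ℂ :=
  if α = (⌈α⌉₊ : ℝ) then (-1) ^ ⌈α⌉₊ * iteratedDeriv ⌈α⌉₊ f t
  else (-1) ^ ⌈α⌉₊ / ((Real.Gamma ((⌈α⌉₊ : ℝ) - α) : ℝ) : ℂ) *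
    iteratedDeriv ⌈α⌉₊
      (fun r : ℝ => ∫ s in Ioi r, (((s - r) ^ ((⌈α⌉₊ : ℝ) - α - 1) : ℝ) : ℂ) * f s) t

/-- `g_α(t) = t^{α-1} / Γ(α)`. -/
def gKer (α t : ℝ) : ℝ := t ^ (α - 1) / Real.Gamma α

/-! ### Vector-valued integration -/

section Integral

variable {E : Type*} [AddCommGroup E] [Module ℂ E] [TopologicalSpace E]

/-- `y = ∫ u dμ` for a function `u` with values in a locally convex space: `u` is scalarly
integrable, and `f(y) = ∫ f(u) dμ` for every continuous linear functional `f`. In a Hausdorff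
locally convex space there is at most one such `y`. -/
def HasIntegral (u : ℝ → E) (μ : Measure ℝ) (y : E) : Prop :=
  ∀ f : E →L[ℂ] ℂ, Integrable (fun t => f (u t)) μ ∧ ∫ t, f (u t) ∂μ = f y

theorem HasIntegral.zero (μ : Measure ℝ) : HasIntegral (fun _ => (0 : E)) μ 0 := by
  intro f
  simp

theorem HasIntegral.add {u v : ℝ → E} {μ : Measure ℝ} {y z : E} (hu : HasIntegral u μ y)
    (hv : HasIntegral v μ z) : HasIntegral (fun t => u t + v t) μ (y + z) := by
  intro f
  simp only [map_add]
  exact ⟨(hu f).1.add (hv f).1, by rw [integral_add (hu f).1 (hv f).1, (hu f).2, (hv f).2]⟩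

theorem HasIntegral.smul {u : ℝ → E} {μ : Measure ℝ} {y : E} (c : ℂ) (hu : HasIntegral u μ y) :
    HasIntegral (fun t => c • u t) μ (c • y) := by
  intro f
  simp only [map_smul]
  exact ⟨(hu f).1.smul c, by rw [integral_smul, (hu f).2]⟩

end Integral

/-! ### Fractionally integrated `C`-semigroups

A family `(S(t))_{t ≥ 0}` of operators is given as a function on `ℝ`, of which only the values at
`t ≥ 0` are ever used. Multivalued linear operators in `E` are identified with their graphs, the
linear subspaces of `E × E`; inclusion of operators is inclusion of graphs. -/

section Semigroup

variable {E : Type*} [AddCommGroup E] [Module ℂ E]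

/-- `(S(t))_{t ≥ 0}` is a global `α`-times integrated `C`-semigroup (`C` need not be injective);
for `α = 0` this is a global `C`-regularized semigroup. -/
structure IsIntegratedSemigroup [TopologicalSpace E] (α : ℝ) (C : E →L[ℂ] E)
    (S : ℝ → E →L[ℂ] E) : Prop where
  /-- strong continuity on `[0, ∞)` -/
  continuousOn : ∀ x : E, ContinuousOn (fun t => S t x) (Ici 0)
  /-- `S(t) C = C S(t)` -/
  comm : ∀ t : ℝ, 0 ≤ t → ∀ x : E, S t (C x) = C (S t x)
  /-- for `α = 0`: `S(t) S(s) = S(t + s) C` -/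
  law_zero : α = 0 → ∀ t s : ℝ, 0 ≤ t → 0 ≤ s → ∀ x : E, S t (S s x) = S (t + s) (C x)
  /-- for `α > 0`: `S(t) S(s) x = [∫_0^{t+s} - ∫_0^t - ∫_0^s] g_α(t + s - r) S(r) C x dr` -/
  law_pos : 0 < α → ∀ t s : ℝ, 0 ≤ t → 0 ≤ s → ∀ x : E, ∃ y₁ y₂ y₃ : E,
    HasIntegral (fun r => ((gKer α (t + s - r) : ℝ) : ℂ) • S r (C x))
      (volume.restrict (Ioc 0 (t + s))) y₁ ∧
    HasIntegral (fun r => ((gKer α (t + s - r) : ℝ) : ℂ) • S r (C x))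
      (volume.restrict (Ioc 0 t)) y₂ ∧
    HasIntegral (fun r => ((gKer α (t + s - r) : ℝ) : ℂ) • S r (C x))
      (volume.restrict (Ioc 0 s)) y₃ ∧
    S t (S s x) = y₁ - y₂ - y₃

/-- There is `w ∈ ℝ` such that the family `{e^{-wt} S(t) : t ≥ 0}` is equicontinuous. -/
def IsExpEquicontinuous [UniformSpace E] (S : ℝ → E →L[ℂ] E) : Prop :=
  ∃ w : ℝ, Equicontinuous
    (fun (t : Ici (0 : ℝ)) (x : E) => ((Real.exp (-w * (t : ℝ)) : ℝ) : ℂ) • S t x)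

/-- The integral generator of `(S(t))_{t ≥ 0}`: all pairs `(x, y)` such that
`S(t) x - g_{α+1}(t) C x = ∫_0^t S(s) y ds` for all `t ≥ 0`. -/
def integralGenerator [TopologicalSpace E] (α : ℝ) (C : E →L[ℂ] E)
    (S : ℝ → E →L[ℂ] E) : Submodule ℂ (E × E) where
  carrier := {p | ∀ t : ℝ, 0 ≤ t → HasIntegral (fun s => S s p.2) (volume.restrict (Ioc 0 t))
    (S t p.1 - ((gKer (α + 1) t : ℝ) : ℂ) • C p.1)}
  zero_mem' := by
    intro t _
    simpa using HasIntegral.zero (E := E) (volume.restrict (Ioc 0 t))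
  add_mem' := by
    intro p q hp hq t ht
    have h := (hp t ht).add (hq t ht)
    simp only [Prod.fst_add, Prod.snd_add, map_add, smul_add]
    rwa [add_sub_add_comm]
  smul_mem' := by
    intro c p hp t ht
    have h := (hp t ht).smul c
    simp only [Prod.smul_fst, Prod.smul_snd, map_smul]
    rwa [smul_sub, smul_comm c] at h

end Semigroup

/-! ### Degenerate `C`-distribution semigroups -/

section Distribution

variable {E : Type*} [AddCommGroup E] [Module ℂ E] [TopologicalSpace E]
  [IsTopologicalAddGroup E] [ContinuousSMul ℂ E]

/-- `G` is a pre-(C-DS). Here `L(E)` carries the topology of uniform convergence on bounded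
sets, so that `G` is an `L(E)`-valued distribution on `ℝ`. -/
structure IsPreCDS (C : E →L[ℂ] E) (G : TestFn →L[ℂ] (E →L[ℂ] E)) : Prop where
  /-- the support of `G` is contained in `[0, ∞)` -/
  support : ∀ φ : TestFn, tsupport φ ⊆ Iio 0 → G φ = 0
  /-- `C G = G C` -/
  comm : ∀ φ : TestFn, C.comp (G φ) = (G φ).comp C
  /-- `G(φ *₀ ψ) C = G(φ) G(ψ)` for all test functions `φ`, `ψ` -/
  conv : ∀ φ ψ : TestFn, (G (convZero φ ψ)).comp C = (G φ).comp (G ψ)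

/-- `e^{-wt} G` is tempered: the `L(E)`-valued distribution `φ ↦ G(e^{-w·} φ)` extends to a
continuous linear map on the Schwartz space. -/
def IsTemperedTwist (w : ℝ) (G : TestFn →L[ℂ] (E →L[ℂ] E)) : Prop :=
  ∃ H : 𝓢(ℝ, ℂ) →L[ℂ] (E →L[ℂ] E), ∀ φ : TestFn, H (toSchwartz φ) = G (expMul w φ)

/-- `G` is an exponential pre-(C-DS). -/
def IsPreCEDS (C : E →L[ℂ] E) (G : TestFn →L[ℂ] (E →L[ℂ] E)) : Prop :=
  IsPreCDS C G ∧ ∃ w : ℝ, IsTemperedTwist w G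

/-- The (integral) generator `G(-δ')` of `G`: all pairs `(x, y)` such that
`G((-δ') * φ) x = G(φ) y` for all test functions `φ` with support in `[0, ∞)`;
note that `(-δ') * φ = -φ'`. -/
def generator (G : TestFn →L[ℂ] (E →L[ℂ] E)) : Submodule ℂ (E × E) where
  carrier := {p | ∀ φ : TestFn, tsupport φ ⊆ Ici 0 → G (-(∂_{(1 : ℝ)} φ)) p.1 = G φ p.2}
  zero_mem' := by
    intro φ _
    simp
  add_mem' := by
    intro p q hp hq φ hφ
    simp only [Prod.fst_add, Prod.snd_add, map_add (G _), hp φ hφ, hq φ hφ]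
  smul_mem' := by
    intro c p hp φ hφ
    simp only [Prod.smul_fst, Prod.smul_snd, map_smul (G _), hp φ hφ]

end Distribution

end CDS

end

noncomputable section

namespace CDS

/-! ### The kernels `g_α` -/

/-! Write `n = ⌈α⌉` and let `I^β` denote the Weyl fractional integral. Then `W^α_+ φ = (-1)^n
I^(n-α) φ^(n)`, and vector integrals are tested against continuous functionals, which separate
points by Hahn–Banach, so the algebra reduces to scalar identities.

Existence and continuity. Choose `w₀ ≥ 0` such that every seminorm of `S(t)x` is at most `e^(w₀ t)
q(x)`, and put `w = w₀ + 1`. For bounded continuous `η`, the Weyl integral of `e^(-wt) η` is at most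
a constant times `‖η‖ e^(-wt)`, so its product with `S(t)x` decays like `e^(-t)`. Sequential
completeness makes the Riemann sums converge, which gives an operator `J η` with `p(J η x) ≤ A ‖η‖
q(x)` (`exists_integralOperator`). Then `G` is `(-1)^n J` composed with `φ ↦ e^(wt) φ^(n)`.
Replacing `φ` by `e^(-wt) φ` turns this inner map into `(d/dt - w)^n`, which acts on Schwartz
functions; hence `e^(-wt) G` is tempered.

Convolution law. After applying a functional, and for `α > 0`, it reads `∫∫ Wφ(t) Wψ(s) law(h)(t,s)
= ∫ W(φ *₀ ψ) h`, where `law(h)` is the right side of the composition law and `h(r) = f(S(r)Cx)`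
(`integral_weylDeriv_convZero`). Both sides integrate `h` against a fixed integrable density, so it
suffices to test enough functions `h`. The test functions are the scalar integrated semigroups, that
is, the Riemann–Liouville integrals of `e^(-mt)`: for them `law(h)(t,s) = h(t)h(s)`, and the
adjointness of the two fractional integrals turns the identity into multiplicativity of the Laplace
transform. These functions determine a density by two applications of Stone–Weierstrass
(`ae_eq_zero_of_integral_rlInt_exp`).

Generator. `W` commutes with `d/dt`, so integration by parts handles `∫_0^t S(s)y ds`, while the
term in `g_(α+1)` contributes a multiple of `∫_0^∞ φ' = -φ(0) = 0`. -/

theorem measurable_gKer (α : ℝ) : Measurable (gKer α) := by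
  unfold gKer
  fun_prop

theorem gKer_nonneg {α t : ℝ} (hα : 0 < α) (ht : 0 ≤ t) : 0 ≤ gKer α t :=
  div_nonneg (Real.rpow_nonneg ht _) (Real.Gamma_pos_of_pos hα).le

theorem intervalIntegrable_gKer {α : ℝ} (hα : 0 < α) (a b : ℝ) :
    IntervalIntegrable (gKer α) volume a b :=
  (intervalIntegral.intervalIntegrable_rpow' (by linarith)).div_const _

theorem continuousOn_gKer (α : ℝ) : ContinuousOn (gKer α) (Ioi 0) :=
  (continuousOn_id.rpow_const fun _ hx => Or.inl (ne_of_gt hx)).div_const _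

theorem gKer_nat_add_one (m : ℕ) (t : ℝ) : gKer (m + 1) t = t ^ m / m.factorial := by
  simp [gKer, Real.Gamma_nat_eq_factorial]

theorem gKer_one (t : ℝ) : gKer 1 t = 1 := by simp [gKer]

/-- The Beta integral, normalised by Gamma factors. It is the source of all semigroup laws for
fractional integrals below. -/
theorem integral_gKer_mul_gKer {a b z : ℝ} (ha : 0 < a) (hb : 0 < b) (hz : 0 < z) :
    ∫ u in (0 : ℝ)..z, gKer a (z - u) * gKer b u = gKer (a + b) z := by
  have key := Complex.betaIntegral_scaled (b : ℂ) (a : ℂ) hz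
  have hG := Complex.Gamma_mul_Gamma_eq_betaIntegral (s := (b : ℂ)) (t := (a : ℂ))
    (by simpa using hb) (by simpa using ha)
  have h1 : ∫ x in (0 : ℝ)..z, (x : ℂ) ^ ((b : ℂ) - 1) * ((z : ℂ) - x) ^ ((a : ℂ) - 1) =
      ((∫ x in (0 : ℝ)..z, x ^ (b - 1) * (z - x) ^ (a - 1) : ℝ) : ℂ) := by
    rw [← intervalIntegral.integral_ofReal]
    refine intervalIntegral.integral_congr fun x hx => ?_
    rw [uIcc_of_le hz.le] at hx
    push_cast
    rw [Complex.ofReal_cpow hx.1, Complex.ofReal_cpow (sub_nonneg.2 hx.2)]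
    push_cast
    rfl
  have ha' := (Real.Gamma_pos_of_pos ha).ne'
  have hb' := (Real.Gamma_pos_of_pos hb).ne'
  have hab' := (Real.Gamma_pos_of_pos (add_pos hb ha)).ne'
  have h2 : (∫ x in (0 : ℝ)..z, x ^ (b - 1) * (z - x) ^ (a - 1)) * Real.Gamma (b + a) =
      z ^ (b + a - 1) * (Real.Gamma b * Real.Gamma a) := by
    apply Complex.ofReal_injective
    push_cast
    rw [← h1, key, ← Complex.Gamma_ofReal, ← Complex.Gamma_ofReal, ← Complex.Gamma_ofReal, hG,
      Complex.ofReal_cpow hz.le]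
    push_cast
    ring
  have h3 : ∀ u, gKer a (z - u) * gKer b u =
      (u ^ (b - 1) * (z - u) ^ (a - 1)) / (Real.Gamma b * Real.Gamma a) := by
    intro u; unfold gKer; field_simp
  simp_rw [h3]
  rw [intervalIntegral.integral_div, gKer, add_comm a b, div_eq_div_iff (by positivity) hab', h2]

/-! ### Fractional integrals -/

/-- The Weyl fractional integral of order `β`. -/
def weylInt (β : ℝ) (f : ℝ → ℂ) (t : ℝ) : ℂ :=
  if β = 0 then f t else ∫ u in Ioi 0, (gKer β u : ℂ) * f (t + u)

/-- The Riemann–Liouville fractional integral of order `α`, based at `0`. -/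
def rlInt (α : ℝ) (k : ℝ → ℂ) (t : ℝ) : ℂ :=
  if α = 0 then k t else ∫ u in (0 : ℝ)..t, (gKer α (t - u) : ℂ) * k u

/-- Order zero is a separate branch of the definitions because `Real.Gamma 0 = 0` makes `gKer 0`
vanish identically. With it, integer `α` falls under the general formula with `β = ⌈α⌉ - α = 0`. -/
theorem weylInt_zero (f : ℝ → ℂ) : weylInt 0 f = f := by ext; simp [weylInt]

theorem rlInt_zero (f : ℝ → ℂ) : rlInt 0 f = f := by ext; simp [rlInt]

theorem weylInt_of_pos {β : ℝ} (hβ : 0 < β) (f : ℝ → ℂ) (t : ℝ) :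
    weylInt β f t = ∫ u in Ioi 0, (gKer β u : ℂ) * f (t + u) := if_neg hβ.ne'

theorem rlInt_of_pos {α : ℝ} (hα : 0 < α) (k : ℝ → ℂ) (t : ℝ) :
    rlInt α k t = ∫ u in (0 : ℝ)..t, (gKer α (t - u) : ℂ) * k u := if_neg hα.ne'

theorem weylInt_eq_zero {β : ℝ} {f : ℝ → ℂ} {R : ℝ} (hf : ∀ t, R < t → f t = 0) {t : ℝ}
    (ht : R < t) : weylInt β f t = 0 := by
  unfold weylInt
  split_ifs
  · exact hf t ht
  · refine setIntegral_eq_zero_of_forall_eq_zero fun u hu => ?_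
    rw [hf _ (by linarith [mem_Ioi.1 hu]), mul_zero]

theorem weylInt_const_mul (β : ℝ) (c : ℂ) (f : ℝ → ℂ) :
    weylInt β (fun t => c * f t) = fun t => c * weylInt β f t := by
  ext t
  unfold weylInt
  split_ifs
  · rfl
  · rw [← integral_const_mul]
    congr 1; ext u; ring

theorem weylInt_comp_add (β : ℝ) (f : ℝ → ℂ) (s t : ℝ) :
    weylInt β (fun z => f (s + z)) t = weylInt β f (s + t) := by
  simp [weylInt, add_assoc]

/-- The kernel `g_α` cut off to `(0, R)`. -/
def gCut (α R : ℝ) : ℝ → ℂ := (Ioo 0 R).indicator fun u => (gKer α u : ℂ)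

theorem integrable_gCut {α : ℝ} (hα : 0 < α) (R : ℝ) : Integrable (gCut α R) := by
  rw [gCut, integrable_indicator_iff measurableSet_Ioo]
  rcases le_total R 0 with h | h
  · simp [Ioo_eq_empty (not_lt.2 h)]
  · exact (((intervalIntegrable_iff_integrableOn_Ioo_of_le h).1
      (intervalIntegrable_gKer hα 0 R)).ofReal)

/-! ### Adjointness of the Weyl and Riemann–Liouville integrals. -/

section Duality

variable {α R : ℝ} {f k : ℝ → ℂ}

theorem integral_gCut_mul_right (hα : 0 < α) {t : ℝ} (ht : t ∈ Ioc 0 R) :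
    ∫ u, gCut α R (t - u) * (Ioc 0 R).indicator k u = rlInt α k t := by
  rw [rlInt_of_pos hα, intervalIntegral.integral_of_le ht.1.le, integral_Ioc_eq_integral_Ioo,
    ← integral_indicator measurableSet_Ioo]
  congr 1
  ext u
  by_cases hu : u ∈ Ioo 0 t
  · rw [indicator_of_mem hu, gCut, indicator_of_mem, indicator_of_mem]
    · exact ⟨hu.1, hu.2.le.trans ht.2⟩
    · exact ⟨by linarith [hu.2], by linarith [hu.1, ht.2]⟩
  · rw [indicator_of_notMem hu]
    by_cases h0 : 0 < u
    · rw [gCut, indicator_of_notMem, zero_mul]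
      exact fun h => hu ⟨h0, by linarith [h.1]⟩
    · rw [indicator_of_notMem (fun h => h0 h.1), mul_zero]

theorem integral_gCut_mul_left (hα : 0 < α) (hf : ∀ t, R < t → f t = 0) {u : ℝ}
    (hu : u ∈ Ioc 0 R) :
    ∫ t, (Ioc 0 R).indicator f t * gCut α R (t - u) = weylInt α f u := by
  rw [weylInt_of_pos hα, ← integral_add_right_eq_self _ u, ← integral_indicator measurableSet_Ioi]
  refine integral_congr_ae ?_
  have : ∀ᵐ v : ℝ, v ≠ R - u := by simp [ae_iff]
  filter_upwards [this] with v hv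
  simp only [add_sub_cancel_right]
  by_cases h0 : 0 < v
  · rw [indicator_of_mem (mem_Ioi.2 h0)]
    by_cases h1 : v + u ≤ R
    · rw [indicator_of_mem (show v + u ∈ Ioc 0 R from ⟨by linarith [hu.1], h1⟩), gCut, indicator_of_mem, add_comm v u, mul_comm]
      exact ⟨h0, lt_of_le_of_ne (by linarith) hv |>.trans_le (by linarith [hu.1])⟩
    · rw [indicator_of_notMem fun h => h1 h.2, hf (u + v) (by linarith)]; simp
  · have hz : gCut α R v = 0 := indicator_of_notMem (fun h => h0 h.1) _
    rw [indicator_of_notMem (show v ∉ Ioi 0 from h0), hz, mul_zero]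

/-- Fubini for `f(t) g_α(t - u) k(u)` on the square `(0, R]²`. Integrability is left as a hypothesis
since it is needed in two regimes: `f` integrable with `k` continuous, and `f` continuous with `k`
possibly singular at `0`. -/
theorem integral_mul_rlInt_of_integrable (hα : 0 < α) (hf : ∀ t, R < t → f t = 0)
    (hint : Integrable (fun p : ℝ × ℝ => (Ioc 0 R).indicator f p.1 * gCut α R (p.1 - p.2) *
      (Ioc 0 R).indicator k p.2) (volume.prod volume)) :
    ∫ t in Ioc 0 R, f t * rlInt α k t = ∫ u in Ioc 0 R, weylInt α f u * k u := by
  have h := integral_integral_swap (f := fun t u => (Ioc 0 R).indicator f t * gCut α R (t - u) *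
      (Ioc 0 R).indicator k u) hint
  rw [← integral_indicator measurableSet_Ioc, ← integral_indicator measurableSet_Ioc]
  refine Eq.trans (integral_congr_ae (Eventually.of_forall fun t => ?_))
    (h.trans (integral_congr_ae (Eventually.of_forall fun u => ?_)))
  · simp_rw [mul_assoc]
    rw [integral_const_mul]
    by_cases ht : t ∈ Ioc 0 R
    · rw [integral_gCut_mul_right hα ht, indicator_of_mem ht, indicator_of_mem ht]
    · simp [indicator_of_notMem ht]
  · simp only []
    rw [integral_mul_const]
    by_cases hu : u ∈ Ioc 0 R
    · rw [integral_gCut_mul_left hα hf hu, indicator_of_mem hu, indicator_of_mem hu]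
    · simp [indicator_of_notMem hu]

/-- The first two factors form the integrand of a convolution of integrable functions (with the
reflected kernel), and the third is bounded. -/
theorem integrable_duality_left (hα : 0 < α) (hf : IntegrableOn f (Ioc 0 R))
    (hk : ContinuousOn k (Icc 0 R)) :
    Integrable (fun p : ℝ × ℝ => (Ioc 0 R).indicator f p.1 * gCut α R (p.1 - p.2) *
      (Ioc 0 R).indicator k p.2) (volume.prod volume) := by
  obtain ⟨C, hC⟩ := isCompact_Icc.exists_bound_of_continuousOn hk
  have h1 := ((hf.integrable_indicator measurableSet_Ioc).convolution_integrand
    (ContinuousLinearMap.mul ℝ ℂ) (integrable_gCut hα R).comp_neg).swap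
  have hm : AEStronglyMeasurable ((Ioc 0 R).indicator k) volume :=
    (aestronglyMeasurable_indicator_iff measurableSet_Ioc).2
      ((hk.mono Ioc_subset_Icc_self).aestronglyMeasurable measurableSet_Ioc)
  refine (h1.mul_bdd (c := |C|) (g := fun p : ℝ × ℝ => (Ioc 0 R).indicator k p.2) hm.comp_snd ?_).congr
    (Eventually.of_forall fun p => ?_)
  · refine Eventually.of_forall fun p => ?_
    by_cases h : p.2 ∈ Ioc 0 R
    · rw [indicator_of_mem h]
      exact (hC _ ⟨h.1.le, h.2⟩).trans (le_abs_self _)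
    · simp [indicator_of_notMem h]
  · simp

theorem integrable_duality_right (hα : 0 < α) (hf : ContinuousOn f (Icc 0 R))
    (hk : IntegrableOn k (Ioc 0 R)) :
    Integrable (fun p : ℝ × ℝ => (Ioc 0 R).indicator f p.1 * gCut α R (p.1 - p.2) *
      (Ioc 0 R).indicator k p.2) (volume.prod volume) := by
  obtain ⟨C, hC⟩ := isCompact_Icc.exists_bound_of_continuousOn hf
  have h1 := ((hk.integrable_indicator measurableSet_Ioc).convolution_integrand
    (ContinuousLinearMap.mul ℝ ℂ) (integrable_gCut hα R))
  have hm : AEStronglyMeasurable ((Ioc 0 R).indicator f) volume :=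
    (aestronglyMeasurable_indicator_iff measurableSet_Ioc).2
      ((hf.mono Ioc_subset_Icc_self).aestronglyMeasurable measurableSet_Ioc)
  refine (h1.bdd_mul (c := |C|) (f := fun p : ℝ × ℝ => (Ioc 0 R).indicator f p.1) hm.comp_fst ?_).congr
    (Eventually.of_forall fun p => ?_)
  · refine Eventually.of_forall fun p => ?_
    by_cases h : p.1 ∈ Ioc 0 R
    · rw [indicator_of_mem h]
      exact (hC _ ⟨h.1.le, h.2⟩).trans (le_abs_self _)
    · simp [indicator_of_notMem h]
  · simp; ring

end Duality

theorem integral_Ioi_eq_integral_Ioc {F : ℝ → ℂ} {R : ℝ} (hF : ∀ t, R < t → F t = 0) :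
    ∫ t in Ioi 0, F t = ∫ t in Ioc 0 R, F t := by
  refine setIntegral_eq_of_subset_of_forall_sdiff_eq_zero measurableSet_Ioi Ioc_subset_Ioi_self ?_
  intro t ht
  refine hF t (lt_of_not_ge fun h => ht.2 ⟨ht.1, h⟩)

/-- The Weyl and Riemann–Liouville fractional integrals are adjoint to each other. -/
theorem integral_mul_rlInt {α R : ℝ} {f k : ℝ → ℂ} (hα : 0 ≤ α) (hf : IntegrableOn f (Ioc 0 R))
    (hf0 : ∀ t, R < t → f t = 0) (hk : ContinuousOn k (Ici 0)) :
    ∫ t in Ioi 0, f t * rlInt α k t = ∫ u in Ioi 0, weylInt α f u * k u := by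
  rcases hα.eq_or_lt with rfl | hα
  · simp [weylInt_zero, rlInt_zero]
  rw [integral_Ioi_eq_integral_Ioc (R := R), integral_Ioi_eq_integral_Ioc (R := R)]
  · exact integral_mul_rlInt_of_integrable hα hf0
      (integrable_duality_left hα hf (hk.mono Icc_subset_Ici_self))
  · intro t ht
    rw [weylInt_eq_zero hf0 ht, zero_mul]
  · intro t ht
    rw [hf0 t ht, zero_mul]

theorem integrableOn_weylInt {α R : ℝ} {f : ℝ → ℂ} (hα : 0 < α) (hf : IntegrableOn f (Ioc 0 R))
    (hf0 : ∀ t, R < t → f t = 0) : IntegrableOn (weylInt α f) (Ioc 0 R) := by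
  have h := (integrable_duality_left (k := fun _ => 1) hα hf continuousOn_const).integral_prod_right
  refine h.integrableOn.congr_fun (fun u hu => ?_) measurableSet_Ioc
  simp only []
  rw [integral_mul_const, integral_gCut_mul_left hα hf0 hu, indicator_of_mem hu, mul_one]

/-- The Weyl fractional integrals form a semigroup. -/
theorem weylInt_weylInt {a b R : ℝ} (ha : 0 ≤ a) (hb : 0 ≤ b) {f : ℝ → ℂ} (hf : Continuous f)
    (hf0 : ∀ t, R < t → f t = 0) : weylInt b (weylInt a f) = weylInt (a + b) f := by
  rcases ha.eq_or_lt with rfl | ha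
  · rw [weylInt_zero, zero_add]
  rcases hb.eq_or_lt with rfl | hb
  · rw [weylInt_zero, add_zero]
  ext t
  have h0 : ∀ z, R - t < z → f (t + z) = 0 := fun z hz => hf0 _ (by linarith)
  have hk : IntegrableOn (fun u => (gKer b u : ℂ)) (Ioc 0 (R - t)) := by
    rcases le_total (R - t) 0 with h | h
    · simp [Ioc_eq_empty (not_lt.2 h)]
    · exact ((intervalIntegrable_iff_integrableOn_Ioc_of_le h).1
        (intervalIntegrable_gKer hb _ _)).ofReal
  -- Duality is applied to the translate `f(t + ·)` with the singular function `k = g_b`; then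
  -- `rlInt a g_b = g_(a+b)` by the Beta integral.
  have h := integral_mul_rlInt_of_integrable (f := fun z => f (t + z)) ha h0
    (integrable_duality_right ha (by fun_prop) hk)
  rw [weylInt_of_pos hb, weylInt_of_pos (add_pos ha hb),
    integral_Ioi_eq_integral_Ioc (R := R - t), integral_Ioi_eq_integral_Ioc (R := R - t)]
  · simp_rw [weylInt_comp_add] at h
    simp_rw [mul_comm _ (weylInt a f _)]
    rw [← h]
    refine setIntegral_congr_fun measurableSet_Ioc fun z hz => ?_
    rw [mul_comm, rlInt_of_pos ha, ← integral_gKer_mul_gKer ha hb hz.1,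
      ← intervalIntegral.integral_ofReal]
    simp
  · intro z hz
    rw [h0 z hz, mul_zero]
  · intro z hz
    rw [weylInt_eq_zero hf0 (by linarith), mul_zero]

/-! ### Smooth functions with compact support -/

theorem hasCompactSupport_iteratedDeriv {f : ℝ → ℂ} (hf : HasCompactSupport f) (n : ℕ) :
    HasCompactSupport (iteratedDeriv n f) := by
  induction n with
  | zero => simpa [iteratedDeriv_zero] using hf
  | succ n ih => rw [iteratedDeriv_succ]; exact ih.deriv

theorem contDiff_iteratedDeriv {f : ℝ → ℂ} (hf : ContDiff ℝ ∞ f) (n : ℕ) :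
    ContDiff ℝ ∞ (iteratedDeriv n f) := by
  rw [iteratedDeriv_eq_iterate]
  exact hf.iterate_deriv n

theorem exists_pos_forall_lt_eq_zero {f : ℝ → ℂ} (hf : HasCompactSupport f) :
    ∃ R, 0 < R ∧ ∀ t, R < t → f t = 0 := by
  obtain ⟨M, hM⟩ := hf.isBounded.exists_norm_le
  refine ⟨max M 1, by simp, fun t ht => ?_⟩
  by_contra h
  have := hM t (subset_tsupport f h)
  rw [Real.norm_eq_abs] at this
  linarith [le_abs_self t, le_max_left M 1]

theorem locallyIntegrable_reflect_gKer {β : ℝ} (hβ : 0 < β) :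
    LocallyIntegrable ((Iio 0).indicator fun u => (gKer β (-u) : ℂ)) := by
  have h : LocallyIntegrable ((Ioi 0).indicator fun u => (gKer β u : ℂ)) := by
    rw [locallyIntegrable_iff]
    intro K hK
    obtain ⟨M, hM⟩ := hK.isBounded.exists_norm_le
    have : IntegrableOn ((Ioi 0).indicator fun u => (gKer β u : ℂ)) (Icc (-|M|) |M|) := by
      rw [IntegrableOn, integrable_indicator_iff measurableSet_Ioi, IntegrableOn,
        Measure.restrict_restrict measurableSet_Ioi]
      refine IntegrableOn.mono_set (t := Ioc 0 |M|) ?_ fun x hx => ⟨hx.1, hx.2.2⟩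
      exact ((intervalIntegrable_iff_integrableOn_Ioc_of_le (abs_nonneg M)).1
        (intervalIntegrable_gKer hβ _ _)).ofReal
    refine this.mono_set fun x hx => abs_le.1 ((hM x hx).trans (le_abs_self M))
  have h2 := h
  rw [locallyIntegrable_iff] at h2 ⊢
  intro K hK
  have h3 := h2 _ (hK.image continuous_neg)
  rw [← integrable_indicator_iff hK.measurableSet]
  rw [← integrable_indicator_iff (hK.image continuous_neg).measurableSet] at h3
  refine h3.comp_neg.congr (Eventually.of_forall fun x => ?_)
  have : -x ∈ (fun a => -a) '' K ↔ x ∈ K := by simp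
  beta_reduce
  by_cases hx : x ∈ K
  · rw [indicator_of_mem hx, indicator_of_mem (this.2 hx)]
    simp [indicator]
  · rw [indicator_of_notMem hx, indicator_of_notMem (mt this.1 hx)]

/-- As a convolution with a locally integrable kernel, the Weyl integral can be differentiated by
putting the derivative on the smooth factor, away from the singularity of `g_β`. -/
theorem weylInt_eq_convolution {β : ℝ} (hβ : 0 < β) (f : ℝ → ℂ) :
    weylInt β f = convolution ((Iio 0).indicator fun u => (gKer β (-u) : ℂ)) f
      (ContinuousLinearMap.mul ℝ ℂ) volume := by
  ext t
  rw [weylInt_of_pos hβ, convolution_def, ← integral_indicator measurableSet_Ioi,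
    ← integral_neg_eq_self]
  congr 1
  ext u
  simp [indicator, sub_eq_add_neg]

theorem hasDerivAt_weylInt {β : ℝ} (hβ : 0 ≤ β) {f : ℝ → ℂ} (hf : ContDiff ℝ ∞ f)
    (hc : HasCompactSupport f) (t : ℝ) :
    HasDerivAt (weylInt β f) (weylInt β (deriv f) t) t := by
  rcases hβ.eq_or_lt with rfl | hβ
  · simp_rw [weylInt_zero]
    exact (hf.differentiable (by simp) t).hasDerivAt
  · rw [weylInt_eq_convolution hβ, weylInt_eq_convolution hβ]
    exact hc.hasDerivAt_convolution_right _ (locallyIntegrable_reflect_gKer hβ)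
      (hf.of_le (by simp)) t

theorem iteratedDeriv_weylInt {β : ℝ} (hβ : 0 ≤ β) {f : ℝ → ℂ} (hf : ContDiff ℝ ∞ f)
    (hc : HasCompactSupport f) (n : ℕ) :
    iteratedDeriv n (weylInt β f) = weylInt β (iteratedDeriv n f) := by
  induction n with
  | zero => simp
  | succ n ih =>
    rw [iteratedDeriv_succ, ih, iteratedDeriv_succ]
    ext t
    exact (hasDerivAt_weylInt hβ (contDiff_iteratedDeriv hf n) (hasCompactSupport_iteratedDeriv hc n) t).deriv

theorem weylInt_one_deriv {f : ℝ → ℂ} (hf : ContDiff ℝ ∞ f) (hc : HasCompactSupport f) :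
    weylInt 1 (deriv f) = fun t => -f t := by
  ext t
  have h1 : HasCompactSupport fun u => f (t + u) := hc.comp_homeomorph (Homeomorph.addLeft t)
  have h2 : ContDiff ℝ 1 fun u => f (t + u) :=
    (hf.comp (contDiff_const.add contDiff_id)).of_le (by simp)
  have := h1.integral_Ioi_deriv_eq h2 0
  rw [weylInt_of_pos one_pos]
  simp only [gKer_one, Complex.ofReal_one, one_mul]
  rw [add_zero] at this
  rw [← this]
  congr 1
  ext u
  rw [deriv_comp_const_add]

/-- Each order-one integral undoes one derivative at the cost of a sign, by the fundamental theorem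
of calculus at infinity. -/
theorem weylInt_nat_iteratedDeriv {f : ℝ → ℂ} (hf : ContDiff ℝ ∞ f) (hc : HasCompactSupport f)
    (n : ℕ) : weylInt n (iteratedDeriv n f) = fun t => (-1) ^ n * f t := by
  induction n with
  | zero => simp [weylInt_zero]
  | succ n ih =>
    obtain ⟨R, -, hR⟩ := exists_pos_forall_lt_eq_zero (hasCompactSupport_iteratedDeriv hc (n + 1))
    have h := weylInt_weylInt (a := 1) (b := n) zero_le_one n.cast_nonneg
      (contDiff_iteratedDeriv hf (n + 1)).continuous hR
    rw [Nat.cast_add, Nat.cast_one, add_comm, ← h, iteratedDeriv_succ,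
      weylInt_one_deriv (contDiff_iteratedDeriv hf n) (hasCompactSupport_iteratedDeriv hc n)]
    have := weylInt_const_mul n (-1) (iteratedDeriv n f)
    simp only [neg_one_mul] at this
    rw [this, ih]
    ext t
    ring

/-! ### The Weyl fractional derivative -/

/-- The substitution `s = r + u` exhibits the inner integral as a Weyl integral, and the derivatives
then pass to `f`. Everything later uses this form. -/
theorem weylDeriv_eq (α : ℝ) {f : ℝ → ℂ} (hf : ContDiff ℝ ∞ f) (hc : HasCompactSupport f) :
    weylDeriv α f = fun t => (-1) ^ ⌈α⌉₊ * weylInt (⌈α⌉₊ - α) (iteratedDeriv ⌈α⌉₊ f) t := by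
  ext t
  unfold weylDeriv
  split_ifs with h
  · rw [← h, sub_self, weylInt_zero]
  · have hpos : 0 < (⌈α⌉₊ : ℝ) - α := sub_pos.2 ((Nat.le_ceil α).lt_of_ne h)
    have hG := (Real.Gamma_pos_of_pos hpos).ne'
    rw [← iteratedDeriv_weylInt hpos.le hf hc]
    have : (fun r : ℝ => ∫ s in Ioi r, (((s - r) ^ ((⌈α⌉₊ : ℝ) - α - 1) : ℝ) : ℂ) * f s) =
        fun r => ((Real.Gamma ((⌈α⌉₊ : ℝ) - α) : ℝ) : ℂ) * weylInt (⌈α⌉₊ - α) f r := by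
      ext r
      rw [weylInt_of_pos hpos, ← integral_const_mul, ← integral_indicator measurableSet_Ioi,
        ← integral_indicator measurableSet_Ioi, ← integral_add_left_eq_self _ r]
      congr 1
      ext u
      have hG' : ((Real.Gamma ((⌈α⌉₊ : ℝ) - α) : ℝ) : ℂ) ≠ 0 := by exact_mod_cast hG
      by_cases hu : 0 < u
      · rw [indicator_of_mem (show r + u ∈ Ioi r by simpa), indicator_of_mem (show u ∈ Ioi 0 from hu),
          add_sub_cancel_left, gKer]
        push_cast
        field_simp
      · rw [indicator_of_notMem (show r + u ∉ Ioi r by simpa using hu),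
          indicator_of_notMem (show u ∉ Ioi 0 from hu)]
    have hG' : ((Real.Gamma ((⌈α⌉₊ : ℝ) - α) : ℝ) : ℂ) ≠ 0 := by exact_mod_cast hG
    rw [this, iteratedDeriv_const_mul_field]
    field_simp

theorem ceil_sub_nonneg (α : ℝ) : 0 ≤ (⌈α⌉₊ : ℝ) - α := sub_nonneg.2 (Nat.le_ceil α)

section Weyl

variable {α : ℝ} {f : ℝ → ℂ}

theorem hasDerivAt_weylDeriv (α : ℝ) (hf : ContDiff ℝ ∞ f) (hc : HasCompactSupport f) (t : ℝ) :
    HasDerivAt (weylDeriv α f) (weylDeriv α (deriv f) t) t := by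
  rw [weylDeriv_eq α hf hc,
    weylDeriv_eq α (by simpa using contDiff_iteratedDeriv hf 1) hc.deriv]
  refine HasDerivAt.const_mul _ ?_
  rw [← iteratedDeriv_succ', iteratedDeriv_succ]
  exact hasDerivAt_weylInt (ceil_sub_nonneg α) (contDiff_iteratedDeriv hf _) (hasCompactSupport_iteratedDeriv hc _) t

theorem continuous_weylDeriv (α : ℝ) (hf : ContDiff ℝ ∞ f) (hc : HasCompactSupport f) :
    Continuous (weylDeriv α f) :=
  continuous_iff_continuousAt.2 fun t => (hasDerivAt_weylDeriv α hf hc t).continuousAt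

theorem weylDeriv_eq_zero (α : ℝ) (hf : ContDiff ℝ ∞ f) (hc : HasCompactSupport f) {R : ℝ}
    (hR : ∀ t, R < t → f t = 0) {t : ℝ} (ht : R < t) : weylDeriv α f t = 0 := by
  rw [weylDeriv_eq α hf hc]
  have : ∀ s, R < s → iteratedDeriv ⌈α⌉₊ f s = 0 := by
    intro s hs
    have h : f =ᶠ[𝓝 s] fun _ => 0 := by
      filter_upwards [Ioi_mem_nhds hs] with z hz using hR z hz
    rw [h.iteratedDeriv_eq]
    simp
  simp only [weylInt_eq_zero this ht, mul_zero]

/-- The orders add up: `I^α I^(n-α) f^(n) = I^n f^(n) = (-1)^n f`, and the two signs cancel. -/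
theorem weylInt_weylDeriv (hα : 0 ≤ α) (hf : ContDiff ℝ ∞ f) (hc : HasCompactSupport f) :
    weylInt α (weylDeriv α f) = f := by
  obtain ⟨R, -, hR⟩ := exists_pos_forall_lt_eq_zero (hasCompactSupport_iteratedDeriv hc ⌈α⌉₊)
  rw [weylDeriv_eq α hf hc, weylInt_const_mul,
    weylInt_weylInt (ceil_sub_nonneg α) hα (contDiff_iteratedDeriv hf _).continuous hR,
    sub_add_cancel, weylInt_nat_iteratedDeriv hf hc]
  ext t
  rw [← mul_assoc, ← mul_pow]
  simp

theorem integral_weylDeriv_mul_rlInt (hα : 0 ≤ α) (hf : ContDiff ℝ ∞ f) (hc : HasCompactSupport f)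
    {k : ℝ → ℂ} (hk : ContinuousOn k (Ici 0)) :
    ∫ t in Ioi 0, weylDeriv α f t * rlInt α k t = ∫ t in Ioi 0, f t * k t := by
  obtain ⟨R, -, hR⟩ := exists_pos_forall_lt_eq_zero hc
  rw [integral_mul_rlInt hα (R := R) ((continuous_weylDeriv α hf hc).integrableOn_Ioc)
    (fun t ht => weylDeriv_eq_zero α hf hc hR ht) hk, weylInt_weylDeriv hα hf hc]

end Weyl

/-! ### Integrable functions determined by their moments -/

/-- Since `θ` is injective on the compact interval, polynomials in `θ` are uniformly dense there by
Stone–Weierstrass. It is used with `θ(u) = e^(-u)` and with `θ(u) = u`. -/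
theorem integral_mul_eq_zero_of_moments {R : ℝ} {N : ℝ → ℂ} (hN : IntegrableOn N (Ioc 0 R))
    {θ : ℝ → ℝ} (hθ : Continuous θ) (hinj : InjOn θ (Icc 0 R))
    (h : ∀ m : ℕ, ∫ u in Ioc 0 R, N u * ((θ u ^ m : ℝ) : ℂ) = 0) {g : ℝ → ℝ} (hg : Continuous g) :
    ∫ u in Ioc 0 R, N u * (g u : ℂ) = 0 := by
  let Θ : C(Icc 0 R, ℝ) := ⟨fun x => θ x, by fun_prop⟩
  let g' : C(Icc 0 R, ℝ) := ⟨fun x => g x, by fun_prop⟩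
  have hsep : (Algebra.adjoin ℝ {Θ}).SeparatesPoints := by
    intro x y hxy
    refine ⟨Θ, ⟨Θ, Algebra.self_mem_adjoin_singleton ℝ Θ, rfl⟩, fun he => hxy ?_⟩
    exact Subtype.ext (hinj x.2 y.2 he)
  have hpoly : ∀ p : Polynomial ℝ, ∫ u in Ioc 0 R, N u * ((p.eval (θ u) : ℝ) : ℂ) = 0 ∧
      IntegrableOn (fun u => N u * ((p.eval (θ u) : ℝ) : ℂ)) (Ioc 0 R) := by
    intro p
    have hi : ∀ q : Polynomial ℝ,
        IntegrableOn (fun u => N u * ((q.eval (θ u) : ℝ) : ℂ)) (Ioc 0 R) := fun q =>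
      hN.mul_continuousOn_of_subset (K := Icc 0 R)
        (Continuous.continuousOn (by fun_prop)) measurableSet_Ioc isCompact_Icc Ioc_subset_Icc_self
    refine ⟨?_, hi p⟩
    induction p using Polynomial.induction_on' with
    | add p q hp hq =>
      have : ∀ u, N u * (((p + q).eval (θ u) : ℝ) : ℂ) =
          N u * ((p.eval (θ u) : ℝ) : ℂ) + N u * ((q.eval (θ u) : ℝ) : ℂ) := by
        intro u; simp [mul_add]
      simp_rw [this]
      rw [integral_add (hi p) (hi q), hp, hq, add_zero]
    | monomial m a =>
      have : ∀ u, N u * (((Polynomial.monomial m a).eval (θ u) : ℝ) : ℂ) =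
          (a : ℂ) * (N u * ((θ u ^ m : ℝ) : ℂ)) := by
        intro u; simp; ring
      simp_rw [this]
      rw [integral_const_mul, h, mul_zero]
  have hgi : IntegrableOn (fun u => N u * (g u : ℂ)) (Ioc 0 R) :=
    hN.mul_continuousOn_of_subset (K := Icc 0 R)
        (Continuous.continuousOn (by fun_prop)) measurableSet_Ioc isCompact_Icc Ioc_subset_Icc_self
  rw [← norm_le_zero_iff]
  refine le_of_forall_pos_le_add fun ε hε => ?_
  set I := ∫ u in Ioc 0 R, ‖N u‖
  have hI : 0 ≤ I := integral_nonneg fun _ => norm_nonneg _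
  -- The tolerance makes the final error at most `I ε / (I + 1) ≤ ε`; the `+ 1` covers `I = 0`.
  obtain ⟨⟨a, ha⟩, hag⟩ := ContinuousMap.exists_mem_subalgebra_near_continuousMap_of_separatesPoints
    _ hsep g' (ε / (I + 1)) (by positivity)
  rw [Algebra.adjoin_singleton_eq_range_aeval] at ha
  obtain ⟨p, rfl⟩ := ha
  have hp := hpoly p
  have hd : ∫ u in Ioc 0 R, N u * (g u : ℂ) =
      ∫ u in Ioc 0 R, (N u * (g u : ℂ) - N u * ((p.eval (θ u) : ℝ) : ℂ)) := by
    rw [integral_sub hgi hp.2, hp.1, sub_zero]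
  rw [hd]
  calc ‖∫ u in Ioc 0 R, (N u * (g u : ℂ) - N u * ((p.eval (θ u) : ℝ) : ℂ))‖
      ≤ ∫ u in Ioc 0 R, ‖N u‖ * (ε / (I + 1)) := by
        refine norm_integral_le_of_norm_le (hN.norm.mul_const _) ?_
        refine (ae_restrict_mem measurableSet_Ioc).mono fun u hu => ?_
        rw [← mul_sub, norm_mul]
        gcongr
        have := (ContinuousMap.norm_coe_le_norm _ (⟨u, Ioc_subset_Icc_self hu⟩ : Icc 0 R)).trans hag.le
        rw [← Complex.ofReal_sub, Complex.norm_real, norm_sub_rev]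
        refine le_of_eq_of_le (congrArg norm ?_) this
        simp [Polynomial.aeval_continuousMap_apply, Θ, g']
    _ = I * (ε / (I + 1)) := integral_mul_const _ _
    _ ≤ 0 + ε := by
        rw [zero_add, mul_div_assoc', div_le_iff₀ (by positivity)]
        nlinarith

theorem ae_eq_zero_of_moments {R : ℝ} {N : ℝ → ℂ} (hN : IntegrableOn N (Ioc 0 R))
    {θ : ℝ → ℝ} (hθ : Continuous θ) (hinj : InjOn θ (Icc 0 R))
    (h : ∀ m : ℕ, ∫ u in Ioc 0 R, N u * ((θ u ^ m : ℝ) : ℂ) = 0) :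
    ∀ᵐ u, u ∈ Ioc 0 R → N u = 0 := by
  have hi := hN.integrable_indicator measurableSet_Ioc
  have := ae_eq_zero_of_integral_contDiff_smul_eq_zero hi.locallyIntegrable fun g hg _ => by
    rw [← integral_mul_eq_zero_of_moments hN hθ hinj h hg.continuous,
      ← integral_indicator measurableSet_Ioc]
    congr 1
    ext u
    by_cases hu : u ∈ Ioc 0 R
    · simp [indicator_of_mem hu, mul_comm]
    · simp [indicator_of_notMem hu]
  filter_upwards [this] with u hu hmem
  rwa [indicator_of_mem hmem] at hu

/-- A function on `(0, R]` is determined by its integrals against the fractional integrals of the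
exponentials `e^{-mt}`. -/
theorem ae_eq_zero_of_integral_rlInt_exp {α R : ℝ} (hα : 0 < α) {N : ℝ → ℂ}
    (hN : IntegrableOn N (Ioc 0 R))
    (h : ∀ m : ℕ, ∫ u in Ioc 0 R, N u * rlInt α (fun v => ((Real.exp (-m * v) : ℝ) : ℂ)) u = 0) :
    ∀ᵐ u, u ∈ Ioc 0 R → N u = 0 := by
  set N' := (Ioc 0 R).indicator N with hN'
  have hN0 : ∀ t, R < t → N' t = 0 := fun t ht => indicator_of_notMem (fun h => not_lt.2 h.2 ht) _
  have hN'i : IntegrableOn N' (Ioc 0 R) := (hN.integrable_indicator measurableSet_Ioc).integrableOn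
  have hW0 : ∀ (k : ℝ → ℂ) t, R < t → weylInt α N' t * k t = 0 := fun k t ht => by
    rw [weylInt_eq_zero hN0 ht, zero_mul]
  have hdual : ∀ k : ℝ → ℂ, Continuous k →
      ∫ u in Ioc 0 R, N u * rlInt α k u = ∫ u in Ioc 0 R, weylInt α N' u * k u := by
    intro k hk
    rw [← integral_Ioi_eq_integral_Ioc (hW0 k), ← integral_mul_rlInt hα.le hN'i hN0 hk.continuousOn,
      integral_Ioi_eq_integral_Ioc (R := R) fun t ht => by rw [hN0 t ht, zero_mul]]
    refine setIntegral_congr_fun measurableSet_Ioc fun u hu => ?_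
    simp only [hN', indicator_of_mem hu]
  -- By duality the hypothesis says that all moments in `e^(-u)` of the Weyl integral of `N` vanish.
  have h1 : ∀ᵐ u, u ∈ Ioc 0 R → weylInt α N' u = 0 := by
    refine ae_eq_zero_of_moments (integrableOn_weylInt hα hN'i hN0)
      (θ := fun u => Real.exp (-u)) (by fun_prop) (fun x _ y _ hxy => ?_) fun m => ?_
    · simpa using hxy
    · rw [← h m, hdual _ (by fun_prop)]
      refine setIntegral_congr_fun measurableSet_Ioc fun u hu => ?_
      simp only [← Real.exp_nat_mul]
      ring_nf
  -- Duality is now read backwards with `k = g_(m+1)`: its Riemann–Liouville integral is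
  -- `g_(α+m+1)`, a multiple of `u^α u^m`. So all power moments of `N(u) u^α` vanish, and `u^α` is
  -- positive on `(0, R]`.
  have h2 : ∀ᵐ u, u ∈ Ioc 0 R → N u * ((u ^ α : ℝ) : ℂ) = 0 := by
    refine ae_eq_zero_of_moments (θ := id) ?_ continuous_id (injOn_id _) fun m => ?_
    · refine hN.mul_continuousOn_of_subset (K := Icc 0 R)
        (Continuous.continuousOn ?_) measurableSet_Ioc isCompact_Icc Ioc_subset_Icc_self
      exact Complex.continuous_ofReal.comp (Real.continuous_rpow_const hα.le)
    · have h3 := hdual (fun u => ((gKer (m + 1) u : ℝ) : ℂ)) (by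
        simp_rw [gKer_nat_add_one]; fun_prop)
      have h4 : ∫ u in Ioc 0 R, weylInt α N' u * ((gKer (m + 1) u : ℝ) : ℂ) = 0 := by
        rw [← integral_zero ℝ ℂ, ← integral_indicator measurableSet_Ioc]
        refine integral_congr_ae ?_
        filter_upwards [h1] with u hu
        by_cases hmem : u ∈ Ioc 0 R
        · rw [indicator_of_mem hmem, hu hmem, zero_mul]
        · rw [indicator_of_notMem hmem]
      have hm : (0 : ℝ) < m + 1 := by positivity
      have hG : ((Real.Gamma (α + (m + 1)) : ℝ) : ℂ) ≠ 0 := by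
        exact_mod_cast (Real.Gamma_pos_of_pos (add_pos hα hm)).ne'
      rw [h4] at h3
      have h5 : ∀ u ∈ Ioc 0 R, N u * ((u ^ α : ℝ) : ℂ) * ((id u ^ m : ℝ) : ℂ) =
          ((Real.Gamma (α + (m + 1)) : ℝ) : ℂ) *
            (N u * rlInt α (fun u => ((gKer (m + 1) u : ℝ) : ℂ)) u) := by
        intro u hu
        have : rlInt α (fun u => ((gKer (m + 1) u : ℝ) : ℂ)) u = ((gKer (α + (m + 1)) u : ℝ) : ℂ) := by
          rw [rlInt_of_pos hα, ← integral_gKer_mul_gKer hα hm hu.1,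
            ← intervalIntegral.integral_ofReal]
          simp
        rw [this, gKer, ← add_assoc, add_sub_cancel_right, Real.rpow_add hu.1, Real.rpow_natCast]
        rw [← add_assoc] at hG
        push_cast
        rw [id]
        field_simp
      rw [setIntegral_congr_fun measurableSet_Ioc h5, integral_const_mul, h3, mul_zero]
  filter_upwards [h2] with u hu hmem
  refine (mul_eq_zero.1 (hu hmem)).resolve_right ?_
  exact_mod_cast (Real.rpow_pos_of_pos hmem.1 α).ne'

/-! ### Scalar integrated semigroups -/

/-- The function `P(v) P(t + s - v)` is `0` at `v = 0` and `P(s) P(t)` at `v = s`; its derivative is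
integrated over `[0, s]`. The first two integrals on the right combine to one over `[t, t + s]`,
which reflection carries to `[0, s]`. -/
theorem primitive_mul_primitive {p : ℝ → ℂ} (hpc : ContinuousOn p (Ioi 0))
    (hpi : ∀ a b, IntervalIntegrable p volume a b) {t s : ℝ} (ht : 0 < t) (hs : 0 < s) :
    (∫ v in (0 : ℝ)..t, p v) * (∫ v in (0 : ℝ)..s, p v) =
      (∫ r in (0 : ℝ)..(t + s), p (t + s - r) * ∫ v in (0 : ℝ)..r, p v) -
      (∫ r in (0 : ℝ)..t, p (t + s - r) * ∫ v in (0 : ℝ)..r, p v) -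
      (∫ r in (0 : ℝ)..s, p (t + s - r) * ∫ v in (0 : ℝ)..r, p v) := by
  set P : ℝ → ℂ := fun r => ∫ v in (0 : ℝ)..r, p v with hP
  have hPc : Continuous P := intervalIntegral.continuous_primitive hpi 0
  have hPd : ∀ r, 0 < r → HasDerivAt P (p r) r := fun r hr =>
    intervalIntegral.integral_hasDerivAt_right (hpi 0 r)
      (hpc.stronglyMeasurableAtFilter isOpen_Ioi r hr) (hpc.continuousAt (Ioi_mem_nhds hr))
  have hi1 : ∀ a b, IntervalIntegrable (fun r => p (t + s - r) * P r) volume a b := fun a b => by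
    have h := (hpi (t + s - a) (t + s - b)).comp_sub_left (t + s)
    simp only [sub_sub_cancel] at h
    exact h.mul_continuousOn hPc.continuousOn
  have hi2 : ∀ a b, IntervalIntegrable (fun r => p r * P (t + s - r)) volume a b := fun a b =>
    (hpi a b).mul_continuousOn (by fun_prop)
  rw [intervalIntegral.integral_interval_sub_left (hi1 _ _) (hi1 _ _)]
  have h1 : ∫ r in t..(t + s), p (t + s - r) * P r = ∫ v in (0 : ℝ)..s, p v * P (t + s - v) := by
    have := intervalIntegral.integral_comp_sub_left (a := t) (b := t + s)
      (fun v => p v * P (t + s - v)) (t + s)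
    simpa using this
  rw [h1]
  have h2 := intervalIntegral.integral_eq_sub_of_hasDerivAt_of_le hs.le
    (f := fun v => P v * P (t + s - v)) (f' := fun v => p v * P (t + s - v) - p (t + s - v) * P v)
    (by fun_prop) (fun v hv => by
      have := (hPd v hv.1).mul ((hPd (t + s - v) (by linarith [hv.2])).comp_const_sub (t + s) v)
      exact this.congr_deriv (by ring)) ((hi2 _ _).sub (hi1 _ _))
  rw [← intervalIntegral.integral_sub (hi2 _ _) (hi1 _ _), h2]
  simp [hP]
  ring

/-- Up to the factor `e^(cr)`, this is the primitive of `p(v) = g_α(v) e^(-cv)`, so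
`primitive_mul_primitive` applies to it. -/
theorem rlInt_exp {α : ℝ} (hα : 0 < α) (c r : ℝ) :
    rlInt α (fun v => ((Real.exp (c * v) : ℝ) : ℂ)) r = ((Real.exp (c * r) : ℝ) : ℂ) *
      ∫ v in (0 : ℝ)..r, (gKer α v : ℂ) * ((Real.exp (-c * v) : ℝ) : ℂ) := by
  rw [rlInt_of_pos hα, ← intervalIntegral.integral_const_mul]
  have := intervalIntegral.integral_comp_sub_left (a := 0) (b := r)
    (fun v => ((Real.exp (c * r) : ℝ) : ℂ) * ((gKer α v : ℂ) * ((Real.exp (-c * v) : ℝ) : ℂ))) r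
  simp only [sub_self, sub_zero] at this
  rw [← this]
  congr 1
  ext u
  have : ((Real.exp (c * u) : ℝ) : ℂ) =
      ((Real.exp (c * r) : ℝ) : ℂ) * ((Real.exp (-c * (r - u)) : ℝ) : ℂ) := by
    rw [← Complex.ofReal_mul, ← Real.exp_add]
    ring_nf
  rw [this]
  ring

theorem intervalIntegrable_gKer_mul_exp {α : ℝ} (hα : 0 < α) (c a b : ℝ) :
    IntervalIntegrable (fun v => (gKer α v : ℂ) * ((Real.exp (c * v) : ℝ) : ℂ)) volume a b :=
  IntervalIntegrable.mul_continuousOn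
    ⟨(intervalIntegrable_gKer hα a b).1.ofReal, (intervalIntegrable_gKer hα a b).2.ofReal⟩
    (by fun_prop)

theorem continuous_rlInt_exp {α : ℝ} (hα : 0 < α) (c : ℝ) :
    Continuous (rlInt α (fun v => ((Real.exp (c * v) : ℝ) : ℂ))) := by
  rw [funext (rlInt_exp hα c)]
  exact (by fun_prop : Continuous fun r : ℝ => ((Real.exp (c * r) : ℝ) : ℂ)).mul
    (intervalIntegral.continuous_primitive (intervalIntegrable_gKer_mul_exp hα (-c)) 0)

/-- The composition law of a scalar `α`-times integrated semigroup, as an expression in `h`. -/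
def lawIntegral (α : ℝ) (h : ℝ → ℂ) (t s : ℝ) : ℂ :=
  (∫ r in Ioc 0 (t + s), (gKer α (t + s - r) : ℂ) * h r) -
  (∫ r in Ioc 0 t, (gKer α (t + s - r) : ℂ) * h r) -
  (∫ r in Ioc 0 s, (gKer α (t + s - r) : ℂ) * h r)

/-- The scalar model: the `α`-fold integral of `e^(ct)` satisfies the composition law with `C = 1`.
Pulling out `e^(c(t+s))` reduces it to the identity for products of primitives. -/
theorem lawIntegral_rlInt_exp {α : ℝ} (hα : 0 < α) (c : ℝ) {t s : ℝ} (ht : 0 < t) (hs : 0 < s) :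
    lawIntegral α (rlInt α (fun v => ((Real.exp (c * v) : ℝ) : ℂ))) t s =
      rlInt α (fun v => ((Real.exp (c * v) : ℝ) : ℂ)) t *
      rlInt α (fun v => ((Real.exp (c * v) : ℝ) : ℂ)) s := by
  have key := primitive_mul_primitive
    (p := fun v => (gKer α v : ℂ) * ((Real.exp (-c * v) : ℝ) : ℂ))
    ((Complex.continuous_ofReal.comp_continuousOn (continuousOn_gKer α)).mul (by fun_prop))
    (intervalIntegrable_gKer_mul_exp hα (-c)) ht hs
  have h1 : ∀ r, (gKer α (t + s - r) : ℂ) * rlInt α (fun v => ((Real.exp (c * v) : ℝ) : ℂ)) r =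
      ((Real.exp (c * (t + s)) : ℝ) : ℂ) *
      ((gKer α (t + s - r) : ℂ) * ((Real.exp (-c * (t + s - r)) : ℝ) : ℂ) *
        ∫ v in (0 : ℝ)..r, (gKer α v : ℂ) * ((Real.exp (-c * v) : ℝ) : ℂ)) := by
    intro r
    have : ((Real.exp (c * r) : ℝ) : ℂ) =
        ((Real.exp (c * (t + s)) : ℝ) : ℂ) * ((Real.exp (-c * (t + s - r)) : ℝ) : ℂ) := by
      rw [← Complex.ofReal_mul, ← Real.exp_add]
      ring_nf
    rw [rlInt_exp hα, this]
    ring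
  unfold lawIntegral
  simp_rw [h1]
  rw [← intervalIntegral.integral_of_le (by positivity), ← intervalIntegral.integral_of_le ht.le,
    ← intervalIntegral.integral_of_le hs.le]
  simp only [intervalIntegral.integral_const_mul]
  rw [← mul_sub, ← mul_sub, ← key, rlInt_exp hα, rlInt_exp hα, mul_add, Real.exp_add]
  push_cast
  ring

/-! ### The scalar convolution identity -/

/-- The kernel of `lawIntegral`. -/
def lawKernel (α t s r : ℝ) : ℝ :=
  gKer α (t + s - r) * ((if r ≤ t + s then 1 else 0) - (if r ≤ t then 1 else 0) -
    (if r ≤ s then 1 else 0))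

theorem measurable_lawKernel (α : ℝ) :
    Measurable fun z : (ℝ × ℝ) × ℝ => lawKernel α z.1.1 z.1.2 z.2 := by
  unfold lawKernel
  refine ((measurable_gKer α).comp (by fun_prop)).mul (((Measurable.ite ?_ ?_ ?_).sub
    (Measurable.ite ?_ ?_ ?_)).sub (Measurable.ite ?_ ?_ ?_)) <;>
  first
  | exact measurable_const
  | exact measurableSet_le (by fun_prop) (by fun_prop)

/-- For `r > t + s` all three conditions fail, so the values of `gKer` at negative arguments never
matter. The constant `3` is a crude bound for the bracket. -/
theorem norm_lawKernel_le {α M t s r : ℝ} (ht : t ∈ Ioc 0 M) (hs : s ∈ Ioc 0 M) (hr : 0 < r) :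
    ‖lawKernel α t s r‖ ≤ 3 * ‖(Icc 0 (M + M)).indicator (gKer α) (t + s - r)‖ := by
  unfold lawKernel
  by_cases h : r ≤ t + s
  · rw [indicator_of_mem (show t + s - r ∈ Icc 0 (M + M) from
      ⟨by linarith, by linarith [ht.2, hs.2]⟩), norm_mul, mul_comm]
    gcongr
    split_ifs <;> norm_num
  · have h1 : ¬ r ≤ t := fun h' => h (by linarith [hs.1])
    have h2 : ¬ r ≤ s := fun h' => h (by linarith [ht.1])
    simp [h, h1, h2]

theorem integrable_indicator_gKer {α M : ℝ} (hα : 0 < α) (hM : 0 ≤ M) :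
    Integrable ((Icc 0 M).indicator (gKer α)) := by
  rw [integrable_indicator_iff measurableSet_Icc, integrableOn_Icc_iff_integrableOn_Ioc]
  exact (intervalIntegrable_iff_integrableOn_Ioc_of_le hM).1 (intervalIntegrable_gKer hα _ _)

section Kernel

variable {α M : ℝ} {F G : ℝ → ℂ}

/-- The singularity at `r = t + s` is integrable, and by translation invariance the integral over
`r` of the dominating kernel is bounded uniformly in `(t, s)`. -/
theorem integrable_mul_lawKernel (hα : 0 < α) (hM : 0 < M) (hF : Continuous F) (hG : Continuous G) :
    Integrable (fun z : (ℝ × ℝ) × ℝ => F z.1.1 * G z.1.2 * (lawKernel α z.1.1 z.1.2 z.2 : ℂ))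
      (((volume.restrict (Ioc 0 M)).prod (volume.restrict (Ioc 0 M))).prod
        (volume.restrict (Ioc 0 (M + M)))) := by
  have hg := integrable_indicator_gKer hα (M := M + M) (by positivity)
  set g := (Icc 0 (M + M)).indicator (gKer α) with hgdef
  have hmeas : AEStronglyMeasurable
      (fun z : (ℝ × ℝ) × ℝ => F z.1.1 * G z.1.2 * (lawKernel α z.1.1 z.1.2 z.2 : ℂ))
      (((volume.restrict (Ioc 0 M)).prod (volume.restrict (Ioc 0 M))).prod
        (volume.restrict (Ioc 0 (M + M)))) := by
    refine Measurable.aestronglyMeasurable ?_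
    exact ((hF.measurable.comp (by fun_prop)).mul (hG.measurable.comp (by fun_prop))).mul
      (Complex.measurable_ofReal.comp (measurable_lawKernel α))
  have hFG : Integrable (fun p : ℝ × ℝ => F p.1 * G p.2)
      ((volume.restrict (Ioc 0 M)).prod (volume.restrict (Ioc 0 M))) :=
    hF.integrableOn_Ioc.mul_prod hG.integrableOn_Ioc
  have hae : ∀ᵐ p ∂((volume.restrict (Ioc 0 M)).prod (volume.restrict (Ioc 0 M))),
      p ∈ Ioc 0 M ×ˢ Ioc 0 M := by
    rw [Measure.prod_restrict]
    exact ae_restrict_mem (measurableSet_Ioc.prod measurableSet_Ioc)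
  have hgi : ∀ p : ℝ × ℝ, Integrable (fun r => ‖F p.1 * G p.2‖ * (3 * ‖g (p.1 + p.2 - r)‖))
      (volume.restrict (Ioc 0 (M + M))) := fun p =>
    (((hg.comp_sub_left (p.1 + p.2)).norm.const_mul _).const_mul _).restrict
  have hbound : ∀ p ∈ Ioc 0 M ×ˢ Ioc 0 M, ∀ᵐ r ∂(volume.restrict (Ioc 0 (M + M))),
      ‖F p.1 * G p.2 * (lawKernel α p.1 p.2 r : ℂ)‖ ≤
        ‖F p.1 * G p.2‖ * (3 * ‖g (p.1 + p.2 - r)‖) := by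
    intro p hp
    filter_upwards [ae_restrict_mem measurableSet_Ioc] with r hr
    rw [norm_mul _ (lawKernel α p.1 p.2 r : ℂ), Complex.norm_real]
    gcongr
    exact norm_lawKernel_le hp.1 hp.2 hr.1
  rw [integrable_prod_iff hmeas]
  refine ⟨?_, ?_⟩
  · filter_upwards [hae] with p hp
    refine (hgi p).mono' ?_ (hbound p hp)
    refine Measurable.aestronglyMeasurable ?_
    exact measurable_const.mul (Complex.measurable_ofReal.comp
      ((measurable_lawKernel α).comp (measurable_const.prodMk measurable_id)))
  · refine Integrable.mono' (hFG.norm.mul_const (3 * ∫ r, ‖g r‖)) hmeas.norm.integral_prod_right' ?_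
    filter_upwards [hae] with p hp
    rw [Real.norm_of_nonneg (integral_nonneg fun _ => norm_nonneg _)]
    calc _ ≤ ∫ r in Ioc 0 (M + M), ‖F p.1 * G p.2‖ * (3 * ‖g (p.1 + p.2 - r)‖) :=
          integral_mono_of_nonneg (Eventually.of_forall fun _ => norm_nonneg _) (hgi p) (hbound p hp)
      _ ≤ ∫ r, ‖F p.1 * G p.2‖ * (3 * ‖g (p.1 + p.2 - r)‖) :=
          setIntegral_le_integral (((hg.comp_sub_left (p.1 + p.2)).norm.const_mul _).const_mul _)
            (Eventually.of_forall fun _ => by positivity)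
      _ = _ := by
          rw [integral_const_mul, integral_const_mul, integral_sub_left_eq_self fun r => ‖g r‖]

theorem integral_lawKernel_mul (hα : 0 < α) {h : ℝ → ℂ} (hh : ContinuousOn h (Icc 0 (M + M)))
    {t s : ℝ} (ht : t ∈ Ioc 0 M) (hs : s ∈ Ioc 0 M) :
    ∫ r in Ioc 0 (M + M), (lawKernel α t s r : ℂ) * h r = lawIntegral α h t s := by
  have hi : IntegrableOn (fun r => (gKer α (t + s - r) : ℂ) * h r) (Ioc 0 (M + M)) := by
    have h1 := (intervalIntegrable_gKer hα (t + s) (t + s - (M + M))).comp_sub_left (t + s)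
    simp only [sub_self, sub_sub_cancel] at h1
    have h2 := (intervalIntegrable_iff_integrableOn_Ioc_of_le (by linarith [ht.1, ht.2])).1 h1
    exact IntegrableOn.mul_continuousOn_of_subset (K := Icc 0 (M + M)) h2.ofReal hh
      measurableSet_Ioc isCompact_Icc Ioc_subset_Icc_self
  have hc : ∀ c, c ≤ M + M → ∫ r in Ioc 0 (M + M), (Iic c).indicator
      (fun r => (gKer α (t + s - r) : ℂ) * h r) r = ∫ r in Ioc 0 c,
        (gKer α (t + s - r) : ℂ) * h r := by
    intro c hc
    rw [setIntegral_indicator measurableSet_Iic]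
    congr 2
    ext r
    exact ⟨fun hr => ⟨hr.1.1, hr.2⟩, fun hr => ⟨⟨hr.1, hr.2.trans hc⟩, hr.2⟩⟩
  unfold lawIntegral
  have hj : ∀ c, IntegrableOn ((Iic c).indicator fun r => (gKer α (t + s - r) : ℂ) * h r)
      (Ioc 0 (M + M)) := fun c => hi.indicator measurableSet_Iic
  have hj2 : IntegrableOn (fun r =>
      (Iic (t + s)).indicator (fun r => (gKer α (t + s - r) : ℂ) * h r) r -
      (Iic t).indicator (fun r => (gKer α (t + s - r) : ℂ) * h r) r) (Ioc 0 (M + M)) :=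
    (hj _).sub (hj _)
  rw [← hc (t + s) (by linarith [ht.2, hs.2]), ← hc t (by linarith [ht.1, ht.2]),
    ← hc s (by linarith [hs.1, hs.2]), ← integral_sub (hj _) (hj _), ← integral_sub hj2 (hj _)]
  congr 1
  ext r
  simp only [lawKernel, indicator, mem_Iic]
  split_ifs <;> push_cast <;> ring

/-- The density in `r` of the functional `h ↦ ∫∫ F(t) G(s) lawIntegral h t s ds dt`. -/
def lawDensity (α M : ℝ) (F G : ℝ → ℂ) (r : ℝ) : ℂ :=
  ∫ p, F p.1 * G p.2 * (lawKernel α p.1 p.2 r : ℂ)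
    ∂((volume.restrict (Ioc 0 M)).prod (volume.restrict (Ioc 0 M)))

theorem integrableOn_lawDensity (hα : 0 < α) (hM : 0 < M) (hF : Continuous F) (hG : Continuous G) :
    IntegrableOn (lawDensity α M F G) (Ioc 0 (M + M)) :=
  (integrable_mul_lawKernel hα hM hF hG).integral_prod_right

/-- Fubini moves the `r`-integration outside, so the left side becomes linear in `h` with a density
independent of `h`. Truncating `h` makes it bounded without changing any integral. -/
theorem integral_integral_lawIntegral (hα : 0 < α) (hM : 0 < M) (hF : Continuous F)
    (hG : Continuous G) {h : ℝ → ℂ} (hh : ContinuousOn h (Icc 0 (M + M))) :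
    ∫ t in Ioc 0 M, F t * ∫ s in Ioc 0 M, G s * lawIntegral α h t s =
      ∫ r in Ioc 0 (M + M), lawDensity α M F G r * h r := by
  obtain ⟨C, hC⟩ := isCompact_Icc.exists_bound_of_continuousOn hh
  set h' := (Ioc 0 (M + M)).indicator h with hh'
  have hm : AEStronglyMeasurable h' (volume.restrict (Ioc 0 (M + M))) :=
    ((aestronglyMeasurable_indicator_iff measurableSet_Ioc).2
      ((hh.mono Ioc_subset_Icc_self).aestronglyMeasurable measurableSet_Ioc)).restrict
  have hint := (integrable_mul_lawKernel hα hM hF hG).mul_bdd (c := |C|)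
    (g := fun z : (ℝ × ℝ) × ℝ => h' z.2) hm.comp_snd (Eventually.of_forall fun z => by
      by_cases hz : z.2 ∈ Ioc 0 (M + M)
      · rw [hh', indicator_of_mem hz]
        exact (hC _ (Ioc_subset_Icc_self hz)).trans (le_abs_self _)
      · simp [hh', indicator_of_notMem hz])
  have h1 := integral_integral_swap
    (f := fun (p : ℝ × ℝ) r => F p.1 * G p.2 * (lawKernel α p.1 p.2 r : ℂ) * h' r) hint
  have h2 := integral_prod _ hint.integral_prod_left
  have h3 : ∫ r in Ioc 0 (M + M), lawDensity α M F G r * h r =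
      ∫ r in Ioc 0 (M + M), lawDensity α M F G r * h' r := by
    refine setIntegral_congr_fun measurableSet_Ioc fun r hr => ?_
    simp only [hh', indicator_of_mem hr]
  rw [h3]
  simp only [lawDensity, ← integral_mul_const]
  rw [← h1, h2]
  refine setIntegral_congr_fun measurableSet_Ioc fun t ht => ?_
  simp only [← integral_const_mul]
  refine setIntegral_congr_fun measurableSet_Ioc fun s hs => ?_
  simp only [← integral_lawKernel_mul hα hh ht hs, mul_assoc, integral_const_mul]
  congr 2
  refine setIntegral_congr_fun measurableSet_Ioc fun r hr => ?_
  simp only [hh', indicator_of_mem hr]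

end Kernel

/-- Multiplicativity of the Laplace transform; only the values of `φ` and `ψ` on `(0, ∞)` enter. -/
theorem integral_convZero_mul_exp (φ ψ : TestFn) (c : ℝ) :
    ∫ t in Ioi 0, convZero φ ψ t * ((Real.exp (c * t) : ℝ) : ℂ) =
      (∫ t in Ioi 0, φ t * ((Real.exp (c * t) : ℝ) : ℂ)) *
      ∫ t in Ioi 0, ψ t * ((Real.exp (c * t) : ℝ) : ℂ) := by
  have hi : ∀ χ : TestFn, IntegrableOn (fun t => χ t * ((Real.exp (c * t) : ℝ) : ℂ)) (Ioi 0) :=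
    fun χ => (Continuous.integrable_of_hasCompactSupport
      (χ.continuous.mul (by fun_prop)) χ.hasCompactSupport.mul_right).integrableOn
  have := integral_posConvolution (hi ψ) (hi φ) (ContinuousLinearMap.mul ℝ ℂ)
  rw [mul_comm]
  refine Eq.trans ?_ this
  congr 1
  ext t
  change (∫ s in (0 : ℝ)..t, φ (t - s) * ψ s) * _ = _
  rw [← intervalIntegral.integral_mul_const]
  congr 1
  ext s
  have : ((Real.exp (c * t) : ℝ) : ℂ) =
      ((Real.exp (c * s) : ℝ) : ℂ) * ((Real.exp (c * (t - s)) : ℝ) : ℂ) := by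
    rw [← Complex.ofReal_mul, ← Real.exp_add]
    ring_nf
  rw [this, ContinuousLinearMap.mul_apply']
  ring

theorem exists_bound_testFn (φ : TestFn) : ∃ R, 0 < R ∧ ∀ t, R < t → φ t = 0 :=
  exists_pos_forall_lt_eq_zero φ.hasCompactSupport

theorem contDiff_testFn (φ : TestFn) : ContDiff ℝ ∞ φ := φ.contDiff

theorem convZero_eq_zero {φ ψ : TestFn} {M : ℝ} (hφ : ∀ t, M < t → φ t = 0)
    (hψ : ∀ t, M < t → ψ t = 0) {t : ℝ} (ht : M + M < t) : convZero φ ψ t = 0 := by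
  refine intervalIntegral.integral_zero_ae (Eventually.of_forall fun s _ => ?_)
  rcases le_or_gt s M with h | h
  · rw [hφ _ (by linarith), zero_mul]
  · rw [hψ _ h, mul_zero]

/-- The scalar form of `G(φ)G(ψ) = G(φ *₀ ψ)C` for `α > 0`, valid for every continuous `h`, whether
or not it satisfies a composition law. -/
theorem integral_weylDeriv_convZero {α : ℝ} (hα : 0 < α) (φ ψ : TestFn) {h : ℝ → ℂ}
    (hh : ContinuousOn h (Ici 0)) :
    ∫ t in Ioi 0, weylDeriv α φ t * ∫ s in Ioi 0, weylDeriv α ψ s * lawIntegral α h t s =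
      ∫ r in Ioi 0, weylDeriv α (convZero φ ψ) r * h r := by
  obtain ⟨R₁, hR₁, h₁⟩ := exists_bound_testFn φ
  obtain ⟨R₂, hR₂, h₂⟩ := exists_bound_testFn ψ
  set M := max R₁ R₂
  have hM : 0 < M := hR₁.trans_le (le_max_left _ _)
  replace h₁ : ∀ t, M < t → φ t = 0 := fun t ht => h₁ t ((le_max_left _ _).trans_lt ht)
  replace h₂ : ∀ t, M < t → ψ t = 0 := fun t ht => h₂ t ((le_max_right _ _).trans_lt ht)
  have hW : ∀ χ : TestFn, Continuous (weylDeriv α χ) := fun χ =>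
    continuous_weylDeriv α (contDiff_testFn χ) χ.hasCompactSupport
  have hW0 : ∀ (χ : TestFn) (R : ℝ), (∀ t, R < t → χ t = 0) → ∀ t, R < t → weylDeriv α χ t = 0 :=
    fun χ R hR t ht => weylDeriv_eq_zero α (contDiff_testFn χ) χ.hasCompactSupport hR ht
  have hWconv := hW0 (convZero φ ψ) (M + M) fun t => convZero_eq_zero h₁ h₂
  have hL : ∀ h : ℝ → ℂ,
      ∫ t in Ioi 0, weylDeriv α φ t * ∫ s in Ioi 0, weylDeriv α ψ s * lawIntegral α h t s =
      ∫ t in Ioc 0 M, weylDeriv α φ t * ∫ s in Ioc 0 M, weylDeriv α ψ s * lawIntegral α h t s := by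
    intro h
    rw [integral_Ioi_eq_integral_Ioc (R := M) fun t ht => by rw [hW0 φ M h₁ t ht, zero_mul]]
    refine setIntegral_congr_fun measurableSet_Ioc fun t _ => ?_
    rw [integral_Ioi_eq_integral_Ioc (R := M) fun t ht => by rw [hW0 ψ M h₂ t ht, zero_mul]]
  have hR : ∀ h : ℝ → ℂ, ∫ r in Ioi 0, weylDeriv α (convZero φ ψ) r * h r =
      ∫ r in Ioc 0 (M + M), weylDeriv α (convZero φ ψ) r * h r := fun h =>
    integral_Ioi_eq_integral_Ioc fun t ht => by rw [hWconv t ht, zero_mul]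
  have hD := integrableOn_lawDensity hα hM (hW φ) (hW ψ)
  have hWi : IntegrableOn (weylDeriv α (convZero φ ψ)) (Ioc 0 (M + M)) := (hW _).integrableOn_Ioc
  have hmul : ∀ {N h : ℝ → ℂ}, IntegrableOn N (Ioc 0 (M + M)) → ContinuousOn h (Icc 0 (M + M)) →
      IntegrableOn (fun r => N r * h r) (Ioc 0 (M + M)) := fun hN hh =>
    hN.mul_continuousOn_of_subset hh measurableSet_Ioc isCompact_Icc Ioc_subset_Icc_self
  -- The two densities agree because they agree on the `α`-fold integrals of `e^(-mt)`, where both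
  -- sides are products of Laplace transforms.
  have hzero : ∀ᵐ r, r ∈ Ioc 0 (M + M) →
      lawDensity α M (weylDeriv α φ) (weylDeriv α ψ) r - weylDeriv α (convZero φ ψ) r = 0 := by
    refine ae_eq_zero_of_integral_rlInt_exp hα (hD.sub hWi) fun m => ?_
    have hq := continuous_rlInt_exp hα (-m)
    simp_rw [sub_mul]
    rw [integral_sub (hmul hD hq.continuousOn) (hmul hWi hq.continuousOn),
      ← integral_integral_lawIntegral hα hM (hW φ) (hW ψ) hq.continuousOn, ← hR, sub_eq_zero,
      integral_weylDeriv_mul_rlInt hα.le (contDiff_testFn _) (convZero φ ψ).hasCompactSupport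
        (by fun_prop), integral_convZero_mul_exp,
      ← integral_weylDeriv_mul_rlInt hα.le (contDiff_testFn φ) φ.hasCompactSupport (by fun_prop),
      ← integral_weylDeriv_mul_rlInt hα.le (contDiff_testFn ψ) ψ.hasCompactSupport (by fun_prop),
      integral_Ioi_eq_integral_Ioc (R := M) fun t ht => by rw [hW0 φ M h₁ t ht, zero_mul],
      integral_Ioi_eq_integral_Ioc (R := M) fun t ht => by rw [hW0 ψ M h₂ t ht, zero_mul],
      ← integral_mul_const]
    refine setIntegral_congr_fun measurableSet_Ioc fun t ht => ?_
    rw [mul_assoc]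
    congr 1
    rw [← integral_const_mul]
    refine setIntegral_congr_fun measurableSet_Ioc fun s hs => ?_
    rw [lawIntegral_rlInt_exp hα _ ht.1 hs.1]
    ring
  rw [hL, hR, integral_integral_lawIntegral hα hM (hW φ) (hW ψ) (hh.mono Icc_subset_Ici_self)]
  refine integral_congr_ae ?_
  rw [EventuallyEq, ae_restrict_iff' measurableSet_Ioc]
  filter_upwards [hzero] with r hr hmem
  rw [sub_eq_zero.1 (hr hmem)]

theorem weylDeriv_zero (f : ℝ → ℂ) : weylDeriv 0 f = f := by
  ext t
  simp [weylDeriv]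

/-- The case `α = 0`, where the composition law has no kernel: Fubini and the change of variables `r
= t + s`, with both test functions cut off to `(0, ∞)`. -/
theorem integral_convZero (φ ψ : TestFn) {h : ℝ → ℂ} (hh : ContinuousOn h (Ici 0)) :
    ∫ t in Ioi 0, φ t * ∫ s in Ioi 0, ψ s * h (t + s) =
      ∫ r in Ioi 0, convZero φ ψ r * h r := by
  obtain ⟨R₁, hR₁, h₁⟩ := exists_bound_testFn φ
  obtain ⟨R₂, hR₂, h₂⟩ := exists_bound_testFn ψ
  set M := max R₁ R₂
  replace h₁ : ∀ t, M < t → φ t = 0 := fun t ht => h₁ t ((le_max_left _ _).trans_lt ht)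
  replace h₂ : ∀ t, M < t → ψ t = 0 := fun t ht => h₂ t ((le_max_right _ _).trans_lt ht)
  have hh₁ : ContinuousOn h (Icc 0 (M + M)) := hh.mono Icc_subset_Ici_self
  obtain ⟨C, hC⟩ := isCompact_Icc.exists_bound_of_continuousOn hh₁
  set h' := (Ioc 0 (M + M)).indicator h with hh'
  have hm : AEStronglyMeasurable h' volume :=
    ((aestronglyMeasurable_indicator_iff measurableSet_Ioc).2
      ((hh₁.mono Ioc_subset_Icc_self).aestronglyMeasurable measurableSet_Ioc))
  have hi : ∀ χ : TestFn, Integrable ((Ioi 0).indicator χ) := fun χ =>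
    (χ.continuous.integrable_of_hasCompactSupport χ.hasCompactSupport).indicator measurableSet_Ioi
  have hint := ((hi φ).convolution_integrand (ContinuousLinearMap.mul ℝ ℂ) (hi ψ)).mul_bdd (c := |C|)
    (g := fun z : ℝ × ℝ => h' z.1) hm.comp_fst (Eventually.of_forall fun z => by
      by_cases hz : z.1 ∈ Ioc 0 (M + M)
      · rw [hh', indicator_of_mem hz]
        exact (hC _ (Ioc_subset_Icc_self hz)).trans (le_abs_self _)
      · simp [hh', indicator_of_notMem hz])
  have key := integral_integral_swap (f := fun r t => ContinuousLinearMap.mul ℝ ℂ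
    ((Ioi 0).indicator φ t) ((Ioi 0).indicator ψ (r - t)) * h' r) hint
  have hl : ∀ r, ∫ t, ContinuousLinearMap.mul ℝ ℂ ((Ioi 0).indicator φ t)
      ((Ioi 0).indicator ψ (r - t)) * h' r = (Ioi 0).indicator (fun r => convZero φ ψ r * h r) r := by
    intro r
    rw [integral_mul_const, ← convolution_def, 
      ← posConvolution_eq_convolution_indicator φ ψ _ volume, posConvolution]
    by_cases hr : 0 < r
    · rw [indicator_of_mem (mem_Ioi.2 hr), indicator_of_mem (mem_Ioi.2 hr)]
      have h3 : ∫ t in (0 : ℝ)..r, ContinuousLinearMap.mul ℝ ℂ (φ t) (ψ (r - t)) =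
          convZero φ ψ r := by
        have := intervalIntegral.integral_comp_sub_left (a := 0) (b := r)
          (fun s => φ (r - s) * ψ s) r
        simp only [sub_sub_cancel, sub_self, sub_zero] at this
        exact this
      rw [h3]
      by_cases hr' : r ≤ M + M
      · rw [hh', indicator_of_mem (show r ∈ Ioc 0 (M + M) from ⟨hr, hr'⟩)]
      · rw [convZero_eq_zero h₁ h₂ (not_le.1 hr'), zero_mul, zero_mul]
    · rw [indicator_of_notMem (show r ∉ Ioi 0 from hr), indicator_of_notMem (show r ∉ Ioi 0 from hr),
        zero_mul]
  simp_rw [hl] at key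
  rw [← integral_indicator measurableSet_Ioi, ← integral_indicator measurableSet_Ioi, key]
  refine integral_congr_ae (Eventually.of_forall fun t => ?_)
  beta_reduce
  by_cases ht : 0 < t
  · rw [indicator_of_mem (mem_Ioi.2 ht), indicator_of_mem (mem_Ioi.2 ht),
      ← integral_indicator measurableSet_Ioi, ← integral_const_mul]
    conv_rhs => rw [← integral_add_left_eq_self _ t]
    refine integral_congr_ae (Eventually.of_forall fun s => ?_)
    simp only [ContinuousLinearMap.mul_apply', add_sub_cancel_left]
    by_cases hs : 0 < s
    · rw [indicator_of_mem (mem_Ioi.2 hs), indicator_of_mem (mem_Ioi.2 hs)]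
      by_cases hts : t ≤ M ∧ s ≤ M
      · rw [hh', indicator_of_mem (show t + s ∈ Ioc 0 (M + M) from
          ⟨by linarith, by linarith [hts.1, hts.2]⟩), mul_assoc]
      · rcases not_and_or.1 hts with h3 | h3
        · simp [h₁ t (not_le.1 h3)]
        · simp [h₂ s (not_le.1 h3)]
    · rw [indicator_of_notMem (show s ∉ Ioi 0 from hs), indicator_of_notMem (show s ∉ Ioi 0 from hs)]
      simp
  · rw [indicator_of_notMem (show t ∉ Ioi 0 from ht), indicator_of_notMem (show t ∉ Ioi 0 from ht)]
    simp

/-! ### Integrals in sequentially complete locally convex spaces -/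

open scoped ComplexOrder in
theorem polynormableSpace_of_locallyConvexSpace {E : Type*} [AddCommGroup E] [Module ℂ E]
    [TopologicalSpace E] [IsTopologicalAddGroup E] [ContinuousSMul ℂ E] [LocallyConvexSpace ℝ E] :
    PolynormableSpace ℂ E := by
  have : LocallyConvexSpace ℂ E := by
    refine LocallyConvexSpace.ofBasisZero ℂ E (fun s : Set E => s)
      (fun s => s ∈ 𝓝 (0 : E) ∧ Convex ℝ s) (LocallyConvexSpace.convex_basis_zero ℝ E) ?_
    exact fun s hs => convex_RCLike_iff_convex_real.2 hs.2
  have : ContinuousSMul ℝ E := IsScalarTower.continuousSMul ℂ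
  exact LocallyConvexSpace.toPolynormableSpace

section Polynormable

variable {E : Type*} [AddCommGroup E] [Module ℂ E]

/-- The continuous seminorm `x ↦ ‖f x‖`. -/
def dualSeminorm [TopologicalSpace E] (f : E →L[ℂ] ℂ) : Seminorm ℂ E :=
  (normSeminorm ℂ ℂ).comp f.toLinearMap

theorem continuous_dualSeminorm [TopologicalSpace E] (f : E →L[ℂ] ℂ) :
    Continuous (dualSeminorm f) := f.continuous.norm

/-! ### Norming functionals and weak integrals. -/

section Topological

variable [TopologicalSpace E] [PolynormableSpace ℂ E]

/-- Hahn–Banach dominated by `p`, starting from `c • z ↦ c p(z)` on the line spanned by `z`. -/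
theorem exists_dual_eq_seminorm {p : Seminorm ℂ E} (hp : Continuous p) (z : E) :
    ∃ f : E →L[ℂ] ℂ, ‖f z‖ = p z ∧ ∀ x, ‖f x‖ ≤ p x := by
  by_cases hz : z = 0
  · exact ⟨0, by simp [hz], fun x => by simp⟩
  · have hcoord : ∀ x : ℂ ∙ z, ‖((p z : ℂ) • (LinearEquiv.coord ℂ E z hz).toLinearMap) x‖ ≤ p x := by
      rintro ⟨x, hx⟩
      obtain ⟨c, rfl⟩ := Submodule.mem_span_singleton.1 hx
      have h1 : LinearEquiv.coord ℂ E z hz ⟨c • z, hx⟩ = c := by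
        have := LinearEquiv.coord_self ℂ E z hz
        have h2 : (⟨c • z, hx⟩ : ℂ ∙ z) = c • ⟨z, Submodule.mem_span_singleton_self z⟩ := rfl
        rw [h2, map_smul, this, smul_eq_mul, mul_one]
      simp only [LinearMap.smul_apply, LinearEquiv.coe_coe, h1, smul_eq_mul, norm_mul, map_smul_eq_mul,
        Complex.norm_real, Real.norm_of_nonneg (apply_nonneg p z)]
      rw [mul_comm]
    obtain ⟨f, hf, hfp⟩ := Module.Dual.exists_continuous_extension_of_le_seminorm _ _ hp hcoord
    refine ⟨f, ?_, hfp⟩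
    have := hf ⟨z, Submodule.mem_span_singleton_self z⟩
    simp only [LinearMap.smul_apply, LinearEquiv.coe_coe, LinearEquiv.coord_self] at this
    rw [this]
    simp

theorem eq_of_forall_dual_eq [T2Space E] {y z : E} (h : ∀ f : E →L[ℂ] ℂ, f y = f z) : y = z := by
  by_contra hne
  obtain ⟨⟨p, hp⟩, hpz⟩ := (PolynormableSpace.withSeminorms ℂ E).separating_of_T1 (y - z)
    (sub_ne_zero.2 hne)
  obtain ⟨f, hf, -⟩ := exists_dual_eq_seminorm hp (y - z)
  apply hpz
  change p (y - z) = 0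
  rw [← hf, map_sub, h, sub_self, norm_zero]

theorem HasIntegral.unique [T2Space E] {u : ℝ → E} {μ : Measure ℝ} {y z : E}
    (hy : HasIntegral u μ y) (hz : HasIntegral u μ z) : y = z :=
  eq_of_forall_dual_eq fun f => (hy f).2.symm.trans (hz f).2

theorem HasIntegral.seminorm_le {u : ℝ → E} {μ : Measure ℝ} {y : E} (hy : HasIntegral u μ y)
    {p : Seminorm ℂ E} (hp : Continuous p) {b : ℝ → ℝ} (hb : Integrable b μ)
    (h : ∀ᵐ t ∂μ, p (u t) ≤ b t) : p y ≤ ∫ t, b t ∂μ := by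
  obtain ⟨f, hf, hfp⟩ := exists_dual_eq_seminorm hp y
  rw [← hf, ← (hy f).2]
  exact norm_integral_le_of_norm_le hb (h.mono fun t ht => (hfp _).trans ht)

theorem exists_seminorm_lt_one_subset {U : Set E} (hU : U ∈ 𝓝 (0 : E)) :
    ∃ p : Seminorm ℂ E, Continuous p ∧ ∀ x, p x < 1 → x ∈ U := by
  have hw := PolynormableSpace.withSeminorms ℂ E
  obtain ⟨⟨s, r⟩, hr, hs⟩ := hw.hasBasis_zero_ball.mem_iff.1 hU
  set P : {p : Seminorm ℂ E // Continuous p} → Seminorm ℂ E := Subtype.val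
  have hcont : Continuous ⇑(s.sup P) := by
    classical
    clear hs hr
    induction s using Finset.induction_on with
    | empty => exact continuous_const
    | insert i s _ ih =>
      rw [Finset.sup_insert, Seminorm.coe_sup]
      exact i.2.sup ih
  have happly : ∀ x, (Real.toNNReal r⁻¹ • s.sup P) x = r⁻¹ * s.sup P x := by
    intro x
    rw [smul_apply, NNReal.smul_def, Real.coe_toNNReal _ (by positivity), smul_eq_mul]
  refine ⟨Real.toNNReal r⁻¹ • s.sup P, ?_, fun x hx => ?_⟩
  · rw [show ⇑(Real.toNNReal r⁻¹ • s.sup P) = fun x => r⁻¹ * s.sup P x from funext happly]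
    exact hcont.const_mul _
  · apply hs
    rw [Seminorm.mem_ball_zero]
    rwa [happly, inv_mul_lt_iff₀ hr, mul_one] at hx

end Topological

/-! #### Riemann sums -/

/-- Rounding down to a multiple of `1 / (N + 1)`. -/
def gridFloor (N : ℕ) (t : ℝ) : ℝ := ⌊t * (N + 1)⌋₊ / (N + 1)

theorem measurable_gridFloor (N : ℕ) : Measurable (gridFloor N) := by
  unfold gridFloor
  exact ((Nat.measurable_floor.comp (measurable_id.mul_const _)) |> fun h =>
    (measurable_from_nat (f := fun n : ℕ => (n : ℝ))).comp h).div_const _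

theorem gridFloor_le (N : ℕ) {t : ℝ} (ht : 0 ≤ t) : gridFloor N t ≤ t := by
  rw [gridFloor, div_le_iff₀ (by positivity)]
  exact Nat.floor_le (by positivity)

theorem lt_gridFloor_add (N : ℕ) (t : ℝ) : t < gridFloor N t + 1 / (N + 1) := by
  rw [gridFloor, ← add_div, lt_div_iff₀ (by positivity)]
  exact Nat.lt_floor_add_one _

theorem gridFloor_nonneg (N : ℕ) (t : ℝ) : 0 ≤ gridFloor N t := by
  unfold gridFloor
  positivity

theorem tendsto_gridFloor {t : ℝ} (ht : 0 ≤ t) :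
    Tendsto (fun N => gridFloor N t) atTop (𝓝 t) := by
  refine tendsto_of_tendsto_of_tendsto_of_le_of_le (g := fun N : ℕ => t - 1 / ((N : ℝ) + 1)) ?_
    tendsto_const_nhds (fun N => ?_) fun N => gridFloor_le N ht
  · simpa using tendsto_const_nhds.sub (tendsto_one_div_add_atTop_nhds_zero_nat (𝕜 := ℝ))
  · have := lt_gridFloor_add N t
    simp only
    linarith

theorem gridFloor_eq {N i : ℕ} {t : ℝ} (h1 : (i : ℝ) / (N + 1) ≤ t) (h2 : t < (i + 1 : ℕ) / (N + 1)) :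
    gridFloor N t = i / (N + 1) := by
  have hN : (0 : ℝ) < N + 1 := by positivity
  rw [gridFloor, (Nat.floor_eq_iff (mul_nonneg ((by positivity : (0 : ℝ) ≤ i / (N + 1)).trans h1)
    hN.le)).2 ⟨(div_le_iff₀ hN).1 h1, ?_⟩]
  rw [lt_div_iff₀ hN] at h2
  exact_mod_cast h2

/-- Riemann sums over `[0, N + 1]` with mesh `1 / (N + 1)`. -/
def riemannSum (u : ℝ → E) (N : ℕ) : E :=
  ∑ i ∈ Finset.range ((N + 1) * (N + 1)), ((1 / (N + 1) : ℝ) : ℂ) • u (i / (N + 1))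

theorem riemannSum_eq_integral (v : ℝ → ℂ) (N : ℕ) :
    riemannSum v N = ∫ t in Ioo 0 ((N : ℝ) + 1), v (gridFloor N t) := by
  have hN : (0 : ℝ) < N + 1 := by positivity
  have hle : ∀ i : ℕ, (i : ℝ) / (N + 1) ≤ (i + 1 : ℕ) / (N + 1) := fun i => by
    gcongr
    simp
  have hcongr : ∀ i : ℕ, EqOn (fun _ => v (i / (N + 1))) (fun t => v (gridFloor N t))
      (Ioo ((i : ℝ) / (N + 1)) ((i + 1 : ℕ) / (N + 1))) := fun i t ht => by
    simp only
    rw [gridFloor_eq ht.1.le ht.2]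
  have h1 : ∀ i : ℕ, IntervalIntegrable (fun t => v (gridFloor N t)) volume
      ((i : ℝ) / (N + 1)) ((i + 1 : ℕ) / (N + 1)) := by
    intro i
    rw [intervalIntegrable_iff_integrableOn_Ioo_of_le (hle i)]
    exact (integrableOn_const (by simp)).congr_fun (hcongr i) measurableSet_Ioo
  have h2 : ∀ i : ℕ, ∫ t in ((i : ℝ) / (N + 1))..((i + 1 : ℕ) / (N + 1)), v (gridFloor N t) =
      ((1 / (N + 1) : ℝ) : ℂ) • v (i / (N + 1)) := by
    intro i
    rw [intervalIntegral.integral_of_le (hle i), integral_Ioc_eq_integral_Ioo,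
      ← setIntegral_congr_fun measurableSet_Ioo (hcongr i), ← integral_Ioc_eq_integral_Ioo,
      ← intervalIntegral.integral_of_le (hle i), intervalIntegral.integral_const, ← sub_div,
      ← Complex.coe_smul]
    push_cast
    rw [add_sub_cancel_left]
  have h3 := intervalIntegral.sum_integral_adjacent_intervals
    (a := fun i : ℕ => (i : ℝ) / (N + 1)) (n := (N + 1) * (N + 1)) fun i _ => h1 i
  rw [riemannSum, Finset.sum_congr rfl fun i _ => (h2 i).symm, h3]
  have h4 : (((N + 1) * (N + 1) : ℕ) : ℝ) / (N + 1) = N + 1 := by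
    push_cast
    field_simp
  simp only [h4, Nat.cast_zero, zero_div]
  rw [intervalIntegral.integral_of_le hN.le, integral_Ioc_eq_integral_Ioo]

theorem map_riemannSum [TopologicalSpace E] (f : E →L[ℂ] ℂ) (u : ℝ → E) (N : ℕ) :
    f (riemannSum u N) = riemannSum (fun t => f (u t)) N := by
  simp [riemannSum]

/-! ### Existence of integrals of exponentially decaying functions. -/

section Integral

variable [UniformSpace E]

/-- The error is uniform over all functionals dominated by `p`; this lets a norming functional that
depends on the Riemann sums be used later to prove the Cauchy property. -/
theorem exists_riemannSum_bound {u : ℝ → E} [IsTopologicalAddGroup E]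
    (hu : Continuous u) {p : Seminorm ℂ E}
    (hp : Continuous p) {D : ℝ} (hD : ∀ t, 0 ≤ t → p (u t) ≤ D * Real.exp (-t)) :
    ∃ δ : ℕ → ℝ, Tendsto δ atTop (𝓝 0) ∧ ∀ (N : ℕ) (f : E →L[ℂ] ℂ), (∀ x, ‖f x‖ ≤ p x) →
      ‖f (riemannSum u N) - ∫ t in Ioi 0, f (u t)‖ ≤ δ N := by
  have hD0 : 0 ≤ D := by simpa using (apply_nonneg p _).trans (hD 0 le_rfl)
  have hexp : IntegrableOn (fun t => Real.exp (-t)) (Ioi 0) := by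
    simpa using integrableOn_exp_neg_Ioi (0 : ℝ)
  -- The pointwise error: mesh error on `[0, N + 1)`, discarded tail beyond it.
  let w : ℕ → ℝ → ℝ := fun N t => if t < N + 1 then p (u (gridFloor N t) - u t) else p (u t)
  have hwm : ∀ N, Measurable (w N) := by
    intro N
    have h1 : Continuous fun z : ℝ × ℝ => p (u z.1 - u z.2) :=
      hp.comp ((hu.comp continuous_fst).sub (hu.comp continuous_snd))
    exact Measurable.ite measurableSet_Iio
      (h1.measurable.comp ((measurable_gridFloor N).prodMk measurable_id)) (hp.comp hu).measurable
  -- Rounding down moves `t` by less than `1`, which costs a factor `e` in the decay.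
  have hgrid : ∀ N t, 0 ≤ t → p (u (gridFloor N t)) ≤ D * Real.exp 1 * Real.exp (-t) := by
    intro N t _
    refine (hD _ (gridFloor_nonneg N t)).trans ?_
    rw [mul_assoc, ← Real.exp_add]
    gcongr
    have h1 := lt_gridFloor_add N t
    have h2 : 1 / ((N : ℝ) + 1) ≤ 1 := by
      rw [div_le_one (by positivity)]
      linarith [(Nat.cast_nonneg N : (0 : ℝ) ≤ N)]
    linarith
  have hwb : ∀ N t, 0 ≤ t → w N t ≤ (D * Real.exp 1 + D) * Real.exp (-t) := by
    intro N t ht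
    rw [add_mul]
    simp only [w]
    split_ifs
    · exact (map_sub_le_add p _ _).trans (add_le_add (hgrid N t ht) (hD t ht))
    · exact (hD t ht).trans (le_add_of_nonneg_left (by positivity))
  have hw0 : ∀ N t, 0 ≤ w N t := by
    intro N t
    simp only [w]
    split_ifs <;> exact apply_nonneg p _
  have hae : ∀ᵐ t ∂(volume.restrict (Ioi (0 : ℝ))), 0 < t := ae_restrict_mem measurableSet_Ioi
  have hwi : ∀ N, IntegrableOn (w N) (Ioi 0) := by
    intro N
    refine (hexp.const_mul (D * Real.exp 1 + D)).mono' (hwm N).aestronglyMeasurable ?_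
    filter_upwards [hae] with t ht
    rw [Real.norm_of_nonneg (hw0 N t)]
    exact hwb N t ht.le
  refine ⟨fun N => ∫ t in Ioi 0, w N t, ?_, fun N f hf => ?_⟩
  · have : Tendsto (fun N => ∫ t in Ioi 0, w N t) atTop (𝓝 (∫ t in Ioi (0 : ℝ), (0 : ℝ))) := by
      refine tendsto_integral_of_dominated_convergence
        (fun t => (D * Real.exp 1 + D) * Real.exp (-t)) (fun N => (hwm N).aestronglyMeasurable)
        (hexp.const_mul _) (fun N => ?_) ?_
      · filter_upwards [hae] with t ht
        rw [Real.norm_of_nonneg (hw0 N t)]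
        exact hwb N t ht.le
      · filter_upwards [hae] with t ht
        have h1 : Tendsto (fun N => p (u (gridFloor N t) - u t)) atTop (𝓝 (p (u t - u t))) :=
          (hp.tendsto _).comp (((hu.tendsto t).comp (tendsto_gridFloor ht.le)).sub_const _)
        rw [sub_self, map_zero] at h1
        refine h1.congr' ?_
        filter_upwards [eventually_ge_atTop ⌈t⌉₊] with N hN
        simp only [w]
        rw [if_pos]
        have := (Nat.le_ceil t).trans (Nat.cast_le.2 hN)
        linarith
    simpa using this
  · have hfu : IntegrableOn (fun t => f (u t)) (Ioi 0) := by
      refine (hexp.const_mul D).mono' (f.continuous.comp hu).aestronglyMeasurable ?_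
      filter_upwards [hae] with t ht using (hf _).trans (hD t ht.le)
    have hfg : IntegrableOn (fun t => f (u (gridFloor N t))) (Ioi 0) := by
      refine (hexp.const_mul (D * Real.exp 1)).mono'
        ((f.continuous.comp hu).measurable.comp (measurable_gridFloor N)).aestronglyMeasurable ?_
      filter_upwards [hae] with t ht using (hf _).trans (hgrid N t ht.le)
    have h1 : f (riemannSum u N) =
        ∫ t in Ioi 0, (Iio ((N : ℝ) + 1)).indicator (fun t => f (u (gridFloor N t))) t := by
      rw [map_riemannSum, riemannSum_eq_integral (fun t => f (u t)),
        setIntegral_indicator measurableSet_Iio, Ioi_inter_Iio]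
    rw [h1, ← integral_sub (hfg.indicator measurableSet_Iio) hfu]
    refine norm_integral_le_of_norm_le (hwi N) (Eventually.of_forall fun t => ?_)
    simp only [w]
    split_ifs with ht
    · rw [indicator_of_mem (mem_Iio.2 ht), ← map_sub]
      exact hf _
    · rw [indicator_of_notMem (show t ∉ Iio _ from ht), zero_sub, norm_neg]
      exact hf _

variable [IsUniformAddGroup E] [PolynormableSpace ℂ E]

theorem exists_hasIntegral_of_continuous
    (hE : ∀ u : ℕ → E, CauchySeq u → ∃ x : E, Tendsto u atTop (𝓝 x)) {u : ℝ → E}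
    (hu : Continuous u) (hb : ∀ p : Seminorm ℂ E, Continuous p →
      ∃ D : ℝ, ∀ t, 0 ≤ t → p (u t) ≤ D * Real.exp (-t)) :
    ∃ y, HasIntegral u (volume.restrict (Ioi 0)) y := by
  have hw := PolynormableSpace.withSeminorms ℂ E
  have hcauchy : CauchySeq (riemannSum u) := by
    rw [cauchySeq_iff_tendsto, uniformity_eq_comap_nhds_zero, tendsto_comap_iff, hw.tendsto_nhds]
    rintro ⟨p, hp⟩ ε hε
    obtain ⟨D, hD⟩ := hb p hp
    obtain ⟨δ, hδ, hδ'⟩ := exists_riemannSum_bound hu hp hD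
    have h1 : ∀ᶠ N in atTop, δ N < ε / 2 := hδ.eventually_lt_const (by positivity)
    rw [← prod_atTop_atTop_eq]
    filter_upwards [h1.prod_mk h1] with z hz
    simp only [Function.comp, Prod.map, sub_zero]
    obtain ⟨f, hf, hfp⟩ := exists_dual_eq_seminorm hp (riemannSum u z.2 - riemannSum u z.1)
    rw [← hf, map_sub]
    have h2 := hδ' z.1 f hfp
    have h3 := hδ' z.2 f hfp
    rw [← sub_sub_sub_cancel_right _ _ (∫ t in Ioi 0, f (u t))]
    refine (norm_sub_le _ _).trans_lt ?_
    linarith [hz.1, hz.2]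
  obtain ⟨y, hy⟩ := hE _ hcauchy
  refine ⟨y, fun f => ⟨?_, ?_⟩⟩
  · obtain ⟨D, hD⟩ := hb _ (continuous_dualSeminorm f)
    have hexp : IntegrableOn (fun t => Real.exp (-t)) (Ioi 0) := by
      simpa using integrableOn_exp_neg_Ioi (0 : ℝ)
    refine (hexp.const_mul D).mono' (f.continuous.comp hu).aestronglyMeasurable ?_
    filter_upwards [ae_restrict_mem measurableSet_Ioi] with t ht using hD t (le_of_lt ht)
  · obtain ⟨D, hD⟩ := hb _ (continuous_dualSeminorm f)
    obtain ⟨δ, hδ, hδ'⟩ := exists_riemannSum_bound hu (continuous_dualSeminorm f) hD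
    have h1 : Tendsto (fun N => f (riemannSum u N)) atTop (𝓝 (f y)) := (f.continuous.tendsto y).comp hy
    have h2 : Tendsto (fun N => f (riemannSum u N)) atTop (𝓝 (∫ t in Ioi 0, f (u t))) := by
      rw [tendsto_iff_norm_sub_tendsto_zero]
      exact squeeze_zero (fun _ => norm_nonneg _) (fun N => hδ' N f fun x => le_rfl) hδ
    exact tendsto_nhds_unique h2 h1

theorem exists_hasIntegral
    (hE : ∀ u : ℕ → E, CauchySeq u → ∃ x : E, Tendsto u atTop (𝓝 x)) {u : ℝ → E}
    (hu : ContinuousOn u (Ici 0)) (hb : ∀ p : Seminorm ℂ E, Continuous p →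
      ∃ D : ℝ, ∀ t, 0 ≤ t → p (u t) ≤ D * Real.exp (-t)) :
    ∃ y, HasIntegral u (volume.restrict (Ioi 0)) y := by
  have hmax : ∀ t, 0 < t → u (max t 0) = u t := fun t ht => by rw [max_eq_left ht.le]
  obtain ⟨y, hy⟩ := exists_hasIntegral_of_continuous hE (u := fun t => u (max t 0))
    (hu.comp_continuous (by fun_prop) fun t => mem_Ici.2 (le_max_right _ _)) fun p hp => by
      obtain ⟨D, hD⟩ := hb p hp
      exact ⟨D, fun t ht => by rw [max_eq_left ht]; exact hD t ht⟩
  refine ⟨y, fun f => ⟨?_, ?_⟩⟩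
  · exact (hy f).1.congr ((ae_restrict_mem measurableSet_Ioi).mono fun t ht => by
      simp only [hmax t ht])
  · rw [← (hy f).2]
    exact setIntegral_congr_fun measurableSet_Ioi fun t ht => by simp only [hmax t ht]

end Integral

end Polynormable

/-! ### Exponentially weighted Weyl integrals -/

open BoundedContinuousFunction LineDeriv

/-- The Weyl integral of order `β` of `t ↦ e^{-wt} η(t)`. -/
def expWeylInt (β w : ℝ) (η : ℝ →ᵇ ℂ) : ℝ → ℂ :=
  weylInt β fun v => ((Real.exp (-w * v) : ℝ) : ℂ) * η v

section ExpWeylInt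

variable {β w : ℝ}

theorem integrableOn_gKer_mul_exp (hβ : 0 < β) (hw : 0 < w) :
    IntegrableOn (fun u => gKer β u * Real.exp (-w * u)) (Ioi 0) := by
  have := integrableOn_rpow_mul_exp_neg_mul_rpow (p := 1) (s := β - 1) (by linarith) one_pos hw
  simp only [Real.rpow_one] at this
  refine Integrable.congr (this.div_const (Real.Gamma β)) (Eventually.of_forall fun u => ?_)
  simp only [gKer]
  ring

theorem expWeylInt_of_pos (hβ : 0 < β) (η : ℝ →ᵇ ℂ) (t : ℝ) :
    expWeylInt β w η t = ((Real.exp (-w * t) : ℝ) : ℂ) *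
      ∫ u in Ioi 0, ((gKer β u * Real.exp (-w * u) : ℝ) : ℂ) * η (t + u) := by
  rw [expWeylInt, weylInt_of_pos hβ, ← integral_const_mul]
  congr 1
  ext u
  rw [mul_add, Real.exp_add]
  push_cast
  ring

theorem norm_gKer_mul_exp_mul_le (hβ : 0 < β) (η : ℝ →ᵇ ℂ) (t : ℝ) {u : ℝ} (hu : 0 < u) :
    ‖((gKer β u * Real.exp (-w * u) : ℝ) : ℂ) * η (t + u)‖ ≤ gKer β u * Real.exp (-w * u) * ‖η‖ := by
  have h0 : 0 ≤ gKer β u * Real.exp (-w * u) := mul_nonneg (gKer_nonneg hβ hu.le) (Real.exp_pos _).le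
  rw [norm_mul, Complex.norm_real, Real.norm_of_nonneg h0]
  gcongr
  exact η.norm_coe_le_norm _

theorem aestronglyMeasurable_gKer_mul_exp_mul (η : ℝ →ᵇ ℂ) (t : ℝ) (μ : Measure ℝ) :
    AEStronglyMeasurable (fun u => ((gKer β u * Real.exp (-w * u) : ℝ) : ℂ) * η (t + u)) μ :=
  (Complex.measurable_ofReal.comp ((measurable_gKer β).mul (by fun_prop))).aestronglyMeasurable.mul
    (η.continuous.comp (by fun_prop)).aestronglyMeasurable

theorem integrableOn_gKer_mul_exp_mul (hβ : 0 < β) (hw : 0 < w) (η : ℝ →ᵇ ℂ) (t : ℝ) :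
    IntegrableOn (fun u => ((gKer β u * Real.exp (-w * u) : ℝ) : ℂ) * η (t + u)) (Ioi 0) :=
  ((integrableOn_gKer_mul_exp hβ hw).mul_const ‖η‖).mono'
    (aestronglyMeasurable_gKer_mul_exp_mul η t _)
    ((ae_restrict_mem measurableSet_Ioi).mono fun _ hu => norm_gKer_mul_exp_mul_le hβ η t hu)

theorem continuous_expWeylInt (hβ : 0 ≤ β) (hw : 0 < w) (η : ℝ →ᵇ ℂ) :
    Continuous (expWeylInt β w η) := by
  rcases hβ.eq_or_lt with rfl | hβ
  · rw [expWeylInt, weylInt_zero]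
    fun_prop
  · rw [funext (expWeylInt_of_pos hβ η)]
    refine Continuous.mul (by fun_prop) ?_
    refine continuous_of_dominated (fun t => aestronglyMeasurable_gKer_mul_exp_mul η t _)
      (fun t => (ae_restrict_mem measurableSet_Ioi).mono fun _ hu =>
        norm_gKer_mul_exp_mul_le hβ η t hu) ((integrableOn_gKer_mul_exp hβ hw).mul_const ‖η‖)
      (Eventually.of_forall fun u => by fun_prop)

/-- The exponential weight factors through translation: `e^(-w(t+u)) = e^(-wt) e^(-wu)`, and `g_β(u)
e^(-wu)` is integrable on `(0, ∞)`. -/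
theorem exists_norm_expWeylInt_le (hβ : 0 ≤ β) (hw : 0 < w) :
    ∃ A, 0 ≤ A ∧ ∀ (η : ℝ →ᵇ ℂ) (t : ℝ), ‖expWeylInt β w η t‖ ≤ A * ‖η‖ * Real.exp (-w * t) := by
  rcases hβ.eq_or_lt with rfl | hβ
  · refine ⟨1, zero_le_one, fun η t => ?_⟩
    rw [expWeylInt, weylInt_zero, norm_mul, Complex.norm_real, Real.norm_of_nonneg (Real.exp_pos _).le,
      one_mul, mul_comm]
    gcongr
    exact η.norm_coe_le_norm t
  · refine ⟨∫ u in Ioi 0, gKer β u * Real.exp (-w * u),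
      setIntegral_nonneg measurableSet_Ioi fun u hu =>
        mul_nonneg (gKer_nonneg hβ (le_of_lt hu)) (Real.exp_pos _).le, fun η t => ?_⟩
    rw [expWeylInt_of_pos hβ, norm_mul, Complex.norm_real, Real.norm_of_nonneg (Real.exp_pos _).le,
      mul_comm]
    gcongr
    rw [← integral_mul_const]
    exact norm_integral_le_of_norm_le ((integrableOn_gKer_mul_exp hβ hw).mul_const ‖η‖)
      ((ae_restrict_mem measurableSet_Ioi).mono fun _ hu => norm_gKer_mul_exp_mul_le hβ η t hu)

theorem expWeylInt_add (hβ : 0 ≤ β) (hw : 0 < w) (η ξ : ℝ →ᵇ ℂ) (t : ℝ) :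
    expWeylInt β w (η + ξ) t = expWeylInt β w η t + expWeylInt β w ξ t := by
  rcases hβ.eq_or_lt with rfl | hβ
  · simp only [expWeylInt, weylInt_zero, BoundedContinuousFunction.add_apply, mul_add]
  · simp only [expWeylInt_of_pos hβ, BoundedContinuousFunction.add_apply, mul_add]
    rw [integral_add (integrableOn_gKer_mul_exp_mul hβ hw η t)
      (integrableOn_gKer_mul_exp_mul hβ hw ξ t), mul_add]

theorem expWeylInt_smul (c : ℂ) (η : ℝ →ᵇ ℂ) (t : ℝ) :
    expWeylInt β w (c • η) t = c * expWeylInt β w η t := by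
  have := congrFun (weylInt_const_mul β c fun v => ((Real.exp (-w * v) : ℝ) : ℂ) * η v) t
  rw [expWeylInt, expWeylInt, ← this]
  congr 1
  ext v
  simp only [BoundedContinuousFunction.smul_apply, smul_eq_mul]
  ring

end ExpWeylInt

/-! ### The operator-valued integrals -/

section Operator

variable {E : Type*} [AddCommGroup E] [Module ℂ E]

/-- For linear maps, equicontinuity at `0` is uniform, so a single seminorm `q` serves all `t`.
Enlarging the exponent to `max w 0` ensures that `w₀ + 1` is positive. -/
theorem IsExpEquicontinuous.exists_seminorm [UniformSpace E] [IsUniformAddGroup E]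
    [ContinuousSMul ℂ E] [PolynormableSpace ℂ E] {S : ℝ → E →L[ℂ] E} (hS : IsExpEquicontinuous S) :
    ∃ w₀ : ℝ, 0 ≤ w₀ ∧ ∀ p : Seminorm ℂ E, Continuous p → ∃ q : Seminorm ℂ E, Continuous q ∧
      ∀ t, 0 ≤ t → ∀ x, p (S t x) ≤ Real.exp (w₀ * t) * q x := by
  obtain ⟨w, hw⟩ := hS
  let T : Ici (0 : ℝ) → E →ₗ[ℂ] E := fun t => ((Real.exp (-w * (t : ℝ)) : ℝ) : ℂ) • (S t).toLinearMap
  have hT : UniformEquicontinuous (DFunLike.coe ∘ T) :=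
    uniformEquicontinuous_of_equicontinuousAt_zero T (hw 0)
  rw [(PolynormableSpace.withSeminorms ℂ E).uniformEquicontinuous_iff_exists_continuous_seminorm] at hT
  refine ⟨max w 0, le_max_right _ _, fun p hp => ?_⟩
  obtain ⟨q, hq, hpq⟩ := hT ⟨p, hp⟩
  refine ⟨q, hq, fun t ht x => ?_⟩
  have h1 : p (((Real.exp (-w * t) : ℝ) : ℂ) • S t x) ≤ q x := hpq ⟨t, ht⟩ x
  rw [map_smul_eq_mul, Complex.norm_real, Real.norm_of_nonneg (Real.exp_pos _).le] at h1
  have h2 : p (S t x) = Real.exp (w * t) * (Real.exp (-w * t) * p (S t x)) := by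
    rw [← mul_assoc, ← Real.exp_add]
    simp
  rw [h2]
  gcongr
  exact le_max_left _ _

variable [UniformSpace E] [IsUniformAddGroup E] [ContinuousSMul ℂ E] [PolynormableSpace ℂ E]
  [T2Space E]

theorem exists_integralOperator
    (hE : ∀ u : ℕ → E, CauchySeq u → ∃ x : E, Tendsto u atTop (𝓝 x))
    {S : ℝ → E →L[ℂ] E} (hS : ∀ x : E, ContinuousOn (fun t => S t x) (Ici 0)) {w₀ : ℝ} (hw₀ : 0 ≤ w₀)
    (hq : ∀ p : Seminorm ℂ E, Continuous p → ∃ q : Seminorm ℂ E, Continuous q ∧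
      ∀ t, 0 ≤ t → ∀ x, p (S t x) ≤ Real.exp (w₀ * t) * q x) {β : ℝ} (hβ : 0 ≤ β) :
    ∃ J : (ℝ →ᵇ ℂ) →L[ℂ] (E →L[ℂ] E), ∀ η x,
      HasIntegral (fun t => expWeylInt β (w₀ + 1) η t • S t x) (volume.restrict (Ioi 0)) (J η x) := by
  have hw : 0 < w₀ + 1 := by linarith
  obtain ⟨A, hA, hAη⟩ := exists_norm_expWeylInt_le hβ hw
  have hexp : IntegrableOn (fun t => Real.exp (-t)) (Ioi 0) := by
    simpa using integrableOn_exp_neg_Ioi (0 : ℝ)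
  have hbound : ∀ (p q : Seminorm ℂ E),
      (∀ t, 0 ≤ t → ∀ x, p (S t x) ≤ Real.exp (w₀ * t) * q x) → ∀ (η : ℝ →ᵇ ℂ) (x : E) (t : ℝ),
      0 ≤ t → p (expWeylInt β (w₀ + 1) η t • S t x) ≤ A * ‖η‖ * q x * Real.exp (-t) := by
    intro p q hpq η x t ht
    rw [map_smul_eq_mul]
    have h1 : A * ‖η‖ * q x * Real.exp (-t) =
        A * ‖η‖ * Real.exp (-(w₀ + 1) * t) * (Real.exp (w₀ * t) * q x) := by
      rw [show -t = -(w₀ + 1) * t + w₀ * t by ring, Real.exp_add]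
      ring
    rw [h1]
    gcongr
    · exact hAη η t
    · exact hpq t ht x
  have hex : ∀ (η : ℝ →ᵇ ℂ) (x : E), ∃ y,
      HasIntegral (fun t => expWeylInt β (w₀ + 1) η t • S t x) (volume.restrict (Ioi 0)) y := by
    intro η x
    refine exists_hasIntegral hE ((continuous_expWeylInt hβ hw η).continuousOn.smul (hS x)) ?_
    intro p hp
    obtain ⟨q, -, hpq⟩ := hq p hp
    exact ⟨A * ‖η‖ * q x, hbound p q hpq η x⟩
  choose J hJ using hex
  -- The weight `w₀ + 1` leaves `e^(-t)`, whose integral is `1`. This one estimate gives continuity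
  -- of each `J η` and, since `q` is bounded on bounded sets, continuity of `J` into `L(E)`.
  have hJle : ∀ (p q : Seminorm ℂ E), Continuous p →
      (∀ t, 0 ≤ t → ∀ x, p (S t x) ≤ Real.exp (w₀ * t) * q x) →
      ∀ (η : ℝ →ᵇ ℂ) (x : E), p (J η x) ≤ A * ‖η‖ * q x := by
    intro p q hp hpq η x
    have h1 := (hJ η x).seminorm_le hp (hexp.const_mul (A * ‖η‖ * q x))
      ((ae_restrict_mem measurableSet_Ioi).mono fun t ht => hbound p q hpq η x t (le_of_lt ht))
    rwa [integral_const_mul, integral_exp_neg_Ioi_zero, mul_one] at h1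
  have hadd : ∀ η x y, J η (x + y) = J η x + J η y := fun η x y =>
    (hJ η (x + y)).unique (by simpa only [map_add, smul_add] using (hJ η x).add (hJ η y))
  have hsmul : ∀ η (c : ℂ) x, J η (c • x) = c • J η x := fun η c x =>
    (hJ η (c • x)).unique (by
      simpa only [map_smul, smul_comm c] using (hJ η x).smul c)
  have hadd' : ∀ η ξ x, J (η + ξ) x = J η x + J ξ x := fun η ξ x =>
    (hJ (η + ξ) x).unique (by
      simpa only [expWeylInt_add hβ hw, add_smul] using (hJ η x).add (hJ ξ x))
  have hsmul' : ∀ (c : ℂ) η x, J (c • η) x = c • J η x := fun c η x =>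
    (hJ (c • η) x).unique (by
      simpa only [expWeylInt_smul, mul_smul] using (hJ η x).smul c)
  let L : (ℝ →ᵇ ℂ) → E →ₗ[ℂ] E := fun η => ⟨⟨J η, hadd η⟩, hsmul η⟩
  have hL : ∀ η, Continuous (L η) := by
    intro η
    refine continuous_of_continuousAt_zero (L η) ?_
    rw [ContinuousAt, map_zero]
    intro U hU
    obtain ⟨p, hp, hpU⟩ := exists_seminorm_lt_one_subset hU
    obtain ⟨q, hqc, hpq⟩ := hq p hp
    have h1 : ∀ᶠ x in 𝓝 (0 : E), A * ‖η‖ * q x < 1 := by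
      have h2 : Tendsto (fun x => A * ‖η‖ * q x) (𝓝 0) (𝓝 (A * ‖η‖ * q 0)) :=
        (hqc.const_mul _).tendsto 0
      rw [map_zero, mul_zero] at h2
      exact h2.eventually_lt_const one_pos
    rw [mem_map]
    filter_upwards [h1] with x hx
    exact hpU _ ((hJle p q hp hpq η x).trans_lt hx)
  let K : (ℝ →ᵇ ℂ) →ₗ[ℂ] (E →L[ℂ] E) :=
    { toFun := fun η => ⟨L η, hL η⟩
      map_add' := fun η ξ => by ext x; exact hadd' η ξ x
      map_smul' := fun c η => by ext x; exact hsmul' c η x }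
  have hK : Continuous K := by
    refine continuous_of_continuousAt_zero K ?_
    rw [ContinuousAt, map_zero, ContinuousLinearMap.hasBasis_nhds_zero.tendsto_right_iff]
    rintro ⟨B, U⟩ ⟨hB, hU⟩
    obtain ⟨p, hp, hpU⟩ := exists_seminorm_lt_one_subset hU
    obtain ⟨q, hqc, hpq⟩ := hq p hp
    obtain ⟨r, hr, hBr⟩ := (PolynormableSpace.withSeminorms ℂ E).isVonNBounded_iff_seminorm_bounded.1
      hB ⟨q, hqc⟩
    have h1 : ∀ᶠ η in 𝓝 (0 : ℝ →ᵇ ℂ), A * ‖η‖ * r < 1 := by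
      have h2 : Tendsto (fun η : ℝ →ᵇ ℂ => A * ‖η‖ * r) (𝓝 0) (𝓝 (A * ‖(0 : ℝ →ᵇ ℂ)‖ * r)) :=
        ((continuous_norm.const_mul _).mul_const _).tendsto 0
      rw [norm_zero, mul_zero, zero_mul] at h2
      exact h2.eventually_lt_const one_pos
    filter_upwards [h1] with η hη x hx
    refine hpU _ ((hJle p q hp hpq η x).trans_lt (lt_of_le_of_lt ?_ hη))
    gcongr
    exact (hBr x hx).le
  exact ⟨⟨K, hK⟩, hJ⟩

end Operator

/-! ### Twisted derivatives of test functions and Schwartz functions -/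

/-- Multiplication by `e^{-wt}` as a continuous linear map on test functions. -/
def expMulCLM (w : ℝ) : TestFn →L[ℂ] TestFn :=
  TestFunction.limitCLM ℂ (expMul w)
    (fun _ hK => (TestFunction.ofSupportedInCLM ℂ hK).comp
      (ContDiffMapSupportedIn.bilinLeftCLM (ContinuousLinearMap.mul ℂ ℂ).flip
        (g := fun t => ((Real.exp (-w * t) : ℝ) : ℂ))
        (Complex.ofRealCLM.contDiff.comp (Real.contDiff_exp.comp (contDiff_const.mul contDiff_id)))))
    fun _ _ _ => rfl

theorem expMulCLM_apply (w : ℝ) (φ : TestFn) (t : ℝ) :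
    expMulCLM w φ t = ((Real.exp (-w * t) : ℝ) : ℂ) * φ t := rfl

theorem lineDeriv_testFn (φ : TestFn) : ⇑(∂_{(1 : ℝ)} φ : TestFn) = deriv φ := by
  ext t
  rw [TestFunction.lineDerivOp_eq_lineDerivCLM ℝ, TestFunction.lineDerivCLM_apply_of_le (by simp),
    (φ.contDiff.differentiable (by simp)).differentiableAt.lineDeriv_eq_fderiv,
    fderiv_apply_one_eq_deriv]

theorem lineDerivOpCLM_pow_apply (n : ℕ) (φ : TestFn) :
    ⇑(((lineDerivOpCLM ℂ TestFn (1 : ℝ)) ^ n) φ) = iteratedDeriv n φ := by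
  induction n with
  | zero => simp
  | succ n ih =>
    rw [pow_succ', iteratedDeriv_succ, ← ih, ← lineDeriv_testFn]
    rfl

/-- The map `φ ↦ e^{wt} φ^{(n)}` from test functions to bounded continuous functions. -/
def testTwist (w : ℝ) (n : ℕ) : TestFn →L[ℂ] (ℝ →ᵇ ℂ) :=
  (TestFunction.toBoundedContinuousFunctionCLM ℂ).comp
    ((expMulCLM (-w)).comp ((lineDerivOpCLM ℂ TestFn (1 : ℝ)) ^ n))

theorem testTwist_apply (w : ℝ) (n : ℕ) (φ : TestFn) (t : ℝ) :
    testTwist w n φ t = ((Real.exp (w * t) : ℝ) : ℂ) * iteratedDeriv n φ t := by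
  change expMulCLM (-w) (((lineDerivOpCLM ℂ TestFn (1 : ℝ)) ^ n) φ) t = _
  rw [expMulCLM_apply, lineDerivOpCLM_pow_apply, neg_neg]

/-- The operator `d/dt - w` on Schwartz functions. -/
def derivSub (w : ℝ) : 𝓢(ℝ, ℂ) →L[ℂ] 𝓢(ℝ, ℂ) :=
  SchwartzMap.derivCLM ℂ ℂ - (w : ℂ) • ContinuousLinearMap.id ℂ _

/-- Conjugating `d/dt` by `e^(-wt)` gives `d/dt - w`. Thus the exponential weights cancel and no
growth is imposed on Schwartz functions. -/
theorem derivSub_pow_apply (w : ℝ) (n : ℕ) (f : 𝓢(ℝ, ℂ)) (t : ℝ) :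
    ((derivSub w) ^ n) f t = ((Real.exp (w * t) : ℝ) : ℂ) *
      iteratedDeriv n (fun v => ((Real.exp (-w * v) : ℝ) : ℂ) * f v) t := by
  induction n generalizing f with
  | zero =>
    simp only [pow_zero, iteratedDeriv_zero, ← mul_assoc, ← Complex.ofReal_mul, ← Real.exp_add]
    simp
  | succ n ih =>
    have h1 : deriv (fun v => ((Real.exp (-w * v) : ℝ) : ℂ) * f v) =
        fun v => ((Real.exp (-w * v) : ℝ) : ℂ) * derivSub w f v := by
      ext v
      have h2 : HasDerivAt (fun v : ℝ => ((Real.exp (-w * v) : ℝ) : ℂ))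
          (((Real.exp (-w * v) * -w : ℝ)) : ℂ) v := by
        refine HasDerivAt.ofReal_comp ?_
        simpa using ((hasDerivAt_id v).const_mul (-w)).exp
      refine (h2.mul (f.hasDerivAt v)).deriv.trans ?_
      change _ = _ * (deriv f v - (w : ℂ) * f v)
      push_cast
      ring
    rw [iteratedDeriv_succ', h1, ← ih, pow_succ]
    rfl

/-- The map `f ↦ e^{wt} (e^{-wt} f)^{(n)}` from Schwartz functions to bounded continuous functions. -/
def schwartzTwist (w : ℝ) (n : ℕ) : 𝓢(ℝ, ℂ) →L[ℂ] (ℝ →ᵇ ℂ) :=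
  (SchwartzMap.toBoundedContinuousFunctionCLM ℂ ℝ ℂ).comp ((derivSub w) ^ n)

theorem schwartzTwist_toSchwartz (w : ℝ) (n : ℕ) (φ : TestFn) :
    schwartzTwist w n (toSchwartz φ) = testTwist w n (expMul w φ) := by
  refine BoundedContinuousFunction.ext fun t => ?_
  rw [testTwist_apply]
  exact derivSub_pow_apply w n (toSchwartz φ) t

theorem weylDeriv_eq_expWeylInt (α w : ℝ) (φ : TestFn) (t : ℝ) :
    weylDeriv α φ t =
      (-1) ^ ⌈α⌉₊ * expWeylInt (⌈α⌉₊ - α) w (testTwist w ⌈α⌉₊ φ) t := by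
  rw [weylDeriv_eq α φ.contDiff φ.hasCompactSupport, expWeylInt]
  dsimp only
  congr 2
  funext v
  rw [testTwist_apply, ← mul_assoc, ← Complex.ofReal_mul, ← Real.exp_add]
  simp

/-! ### The generator -/

theorem integrableOn_mul_of_eq_zero {F h : ℝ → ℂ} (hF : Continuous F) {R : ℝ} (hR : 0 ≤ R)
    (hFR : ∀ t, R < t → F t = 0) (hh : ContinuousOn h (Ici 0)) :
    IntegrableOn (fun t => F t * h t) (Ioi 0) := by
  rw [← Ioc_union_Ioi_eq_Ioi hR]
  refine IntegrableOn.union ?_ ?_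
  · have h1 : ContinuousOn (fun t => F t * h t) (Icc 0 R) :=
      hF.continuousOn.mul (hh.mono Icc_subset_Ici_self)
    exact h1.integrableOn_Icc.mono_set Ioc_subset_Icc_self
  · refine (integrableOn_zero : IntegrableOn (fun _ : ℝ => (0 : ℂ)) (Ioi R)).congr_fun (fun t ht => ?_) measurableSet_Ioi
    dsimp only
    rw [hFR t ht, zero_mul]

theorem rlInt_one {α : ℝ} (hα : 0 ≤ α) {t : ℝ} (ht : 0 < t) :
    rlInt α (fun _ => 1) t = (gKer (α + 1) t : ℂ) := by
  rcases hα.eq_or_lt with rfl | hα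
  · rw [rlInt_zero, zero_add, gKer_one, Complex.ofReal_one]
  · rw [rlInt_of_pos hα, ← integral_gKer_mul_gKer hα one_pos ht, ← intervalIntegral.integral_ofReal]
    simp [gKer_one]

/-! ### Integration by parts against Weyl derivatives. -/

section IntegrationByParts

variable {α : ℝ} {φ : TestFn}

/-- Here `g_(α+1)` is the Riemann–Liouville integral of `1`, so duality reduces the left side to
`∫_0^∞ φ' = -φ(0)`. -/
theorem integral_weylDeriv_deriv_mul_gKer (hα : 0 ≤ α) (hφ : φ 0 = 0) :
    ∫ t in Ioi 0, weylDeriv α (deriv φ) t * (gKer (α + 1) t : ℂ) = 0 := by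
  have hd : ContDiff ℝ ∞ (deriv φ) := by simpa using contDiff_iteratedDeriv φ.contDiff 1
  have h1 := integral_weylDeriv_mul_rlInt hα hd φ.hasCompactSupport.deriv
    (k := fun _ => 1) continuousOn_const
  rw [setIntegral_congr_fun (g := fun t => weylDeriv α (deriv φ) t * rlInt α (fun _ => 1) t)
    measurableSet_Ioi fun t ht => by simp only [rlInt_one hα (mem_Ioi.1 ht)], h1]
  simp only [mul_one]
  obtain ⟨R, hR, hφR⟩ := exists_bound_testFn φ
  have hdiff : Differentiable ℝ φ := φ.contDiff.differentiable (by simp)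
  have h2 := integral_Ioi_of_hasDerivAt_of_tendsto' (f := φ) (f' := deriv φ) (a := 0) (m := 0)
    (fun t _ => (hdiff t).hasDerivAt)
    (hd.continuous.integrable_of_hasCompactSupport φ.hasCompactSupport.deriv).integrableOn
    (tendsto_const_nhds.congr' ((eventually_gt_atTop R).mono fun t ht => (hφR t ht).symm))
  rw [h2, hφ, sub_zero]

/-- Weyl differentiation commutes with `d/dt`. The boundary terms vanish because the primitive is
`0` at `0` and `weylDeriv α φ` vanishes to the right of the support of `φ`. -/
theorem integral_weylDeriv_deriv_mul_primitive {k : ℝ → ℂ} (hk : Continuous k) :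
    ∫ t in Ioi 0, weylDeriv α (deriv φ) t * ∫ s in (0 : ℝ)..t, k s =
      -∫ t in Ioi 0, weylDeriv α φ t * k t := by
  have hd : ContDiff ℝ ∞ (deriv φ) := by simpa using contDiff_iteratedDeriv φ.contDiff 1
  have hdc := φ.hasCompactSupport.deriv
  obtain ⟨R, hR, hφR⟩ := exists_bound_testFn φ
  have hK : ∀ t, HasDerivAt (fun t => ∫ s in (0 : ℝ)..t, k s) (k t) t := fun t =>
    hk.integral_hasStrictDerivAt 0 t |>.hasDerivAt
  have hKc : Continuous fun t => ∫ s in (0 : ℝ)..t, k s :=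
    continuous_iff_continuousAt.2 fun t => (hK t).continuousAt
  have hW : ∀ t, R < t → weylDeriv α φ t = 0 := fun t => weylDeriv_eq_zero α φ.contDiff φ.hasCompactSupport hφR
  have hWd := continuous_weylDeriv α hd hdc
  have hWc := continuous_weylDeriv α φ.contDiff φ.hasCompactSupport
  have hφR' : ∀ t, R < t → deriv φ t = 0 := by
    intro t ht
    have : φ =ᶠ[𝓝 t] fun _ => 0 := by
      filter_upwards [lt_mem_nhds ht] with s hs using hφR s hs
    rw [this.deriv_eq, deriv_const]
  have hi₁ := integrableOn_mul_of_eq_zero hWd hR.le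
    (fun t ht => weylDeriv_eq_zero α hd hdc hφR' ht) hKc.continuousOn
  have hi₂ := integrableOn_mul_of_eq_zero hWc hR.le hW hk.continuousOn
  have h := integral_Ioi_of_hasDerivAt_of_tendsto' (a := 0) (m := 0)
    (fun t _ => (hasDerivAt_weylDeriv α φ.contDiff φ.hasCompactSupport t).mul (hK t))
    (hi₁.add hi₂)
    (tendsto_const_nhds.congr' ((eventually_gt_atTop R).mono fun t ht => by
      simp [hW t ht]))
  rw [integral_add hi₁ hi₂] at h
  simp only [Pi.mul_apply, intervalIntegral.integral_same, mul_zero, sub_zero] at h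
  exact eq_neg_of_add_eq_zero_left h

end IntegrationByParts

/-! ### The distribution associated with an integrated semigroup -/

section Main

variable {E : Type*} [AddCommGroup E] [Module ℂ E] [UniformSpace E] [IsUniformAddGroup E]
  [ContinuousSMul ℂ E] [PolynormableSpace ℂ E] [T2Space E] {α : ℝ} {C : E →L[ℂ] E}
  {S : ℝ → E →L[ℂ] E} {G : TestFn →L[ℂ] (E →L[ℂ] E)}

theorem isPreCDS_of_hasIntegral (hα : 0 ≤ α) (hS : IsIntegratedSemigroup α C S)
    (hG : ∀ (φ : TestFn) (x : E),
      HasIntegral (fun t => weylDeriv α φ t • S t x) (volume.restrict (Ioi 0)) (G φ x)) :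
    IsPreCDS C G := by
  refine ⟨fun φ hφ => ?_, fun φ => ?_, fun φ ψ => ?_⟩
  · ext x
    refine (hG φ x).unique fun f => ?_
    -- The Weyl derivative at `t` only sees values of `φ` to the right of points near `t`.
    have h0 : ∀ t, 0 < t → weylDeriv α φ t = 0 := fun t ht =>
      weylDeriv_eq_zero α φ.contDiff φ.hasCompactSupport (R := 0)
        (fun s hs => image_eq_zero_of_notMem_tsupport fun h => lt_asymm hs (hφ h)) ht
    have h1 : (fun t => f (weylDeriv α φ t • S t x)) =ᵐ[volume.restrict (Ioi 0)] fun _ => 0 :=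
      (ae_restrict_mem measurableSet_Ioi).mono fun t ht => by simp [h0 t ht]
    refine ⟨(integrable_zero _ _ _).congr h1.symm, ?_⟩
    rw [integral_congr_ae h1]
    simp
  · ext x
    refine eq_of_forall_dual_eq fun f => ?_
    change f.comp C (G φ x) = f (G φ (C x))
    rw [← (hG φ x (f.comp C)).2, ← (hG φ (C x) f).2]
    refine setIntegral_congr_fun measurableSet_Ioi fun t ht => ?_
    dsimp only
    rw [map_smul, map_smul, hS.comm t (le_of_lt ht)]
    rfl
  · ext x
    refine eq_of_forall_dual_eq fun f => ?_
    change f (G (convZero φ ψ) (C x)) = f (G φ (G ψ x))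
    have hh : ContinuousOn (fun r => f (S r (C x))) (Ici 0) :=
      f.continuous.comp_continuousOn (hS.continuousOn (C x))
    have h1 : f (G φ (G ψ x)) = ∫ t in Ioi 0, weylDeriv α φ t *
        ∫ s in Ioi 0, weylDeriv α ψ s * f (S t (S s x)) := by
      rw [← (hG φ (G ψ x) f).2]
      congr 1
      ext t
      rw [map_smul, smul_eq_mul]
      congr 1
      -- Since `f ∘ S(t)` is again a continuous functional, the weak integral for `G(ψ)x` can be
      -- tested against it; no vector-valued Fubini theorem is required.
      change f.comp (S t) (G ψ x) = _
      rw [← (hG ψ x (f.comp (S t))).2]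
      congr 1
      ext s
      rw [map_smul, smul_eq_mul]
      rfl
    have h2 : f (G (convZero φ ψ) (C x)) =
        ∫ r in Ioi 0, weylDeriv α (convZero φ ψ) r * f (S r (C x)) := by
      rw [← (hG (convZero φ ψ) (C x) f).2]
      simp only [map_smul, smul_eq_mul]
    rw [h1, h2]
    rcases hα.eq_or_lt with rfl | hα
    · simp only [weylDeriv_zero]
      rw [← integral_convZero φ ψ hh]
      refine setIntegral_congr_fun measurableSet_Ioi fun t ht => ?_
      congr 1
      refine setIntegral_congr_fun measurableSet_Ioi fun s hs => ?_
      rw [hS.law_zero rfl t s (le_of_lt ht) (le_of_lt hs)]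
    · rw [← integral_weylDeriv_convZero hα φ ψ hh]
      refine setIntegral_congr_fun measurableSet_Ioi fun t ht => ?_
      congr 1
      refine setIntegral_congr_fun measurableSet_Ioi fun s hs => ?_
      congr 1
      obtain ⟨y₁, y₂, y₃, hy₁, hy₂, hy₃, hy⟩ := hS.law_pos hα t s (le_of_lt ht) (le_of_lt hs) x
      rw [hy, map_sub, map_sub, ← (hy₁ f).2, ← (hy₂ f).2, ← (hy₃ f).2, lawIntegral]
      simp only [map_smul, smul_eq_mul]

theorem integralGenerator_le_generator (hα : 0 ≤ α) (hS : IsIntegratedSemigroup α C S)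
    (hG : ∀ (φ : TestFn) (x : E),
      HasIntegral (fun t => weylDeriv α φ t • S t x) (volume.restrict (Ioi 0)) (G φ x)) :
    integralGenerator α C S ≤ generator G := by
  rintro ⟨x, y⟩ hxy φ hφ
  change ∀ t : ℝ, 0 ≤ t → HasIntegral (fun s => S s y) (volume.restrict (Ioc 0 t))
    (S t x - ((gKer (α + 1) t : ℝ) : ℂ) • C x) at hxy
  change G (-(∂_{(1 : ℝ)} φ)) x = G φ y
  -- The support lies in `[0, ∞)`, so the left limit at `0` is zero; continuity does the rest.
  have hφ0 : φ 0 = 0 := by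
    have h1 : Tendsto φ (𝓝[<] 0) (𝓝 (φ 0)) := φ.contDiff.continuous.continuousWithinAt
    refine tendsto_nhds_unique h1 (tendsto_const_nhds.congr' ?_)
    filter_upwards [self_mem_nhdsWithin] with t ht
    exact (image_eq_zero_of_notMem_tsupport fun h => not_le.2 (mem_Iio.1 ht) (mem_Ici.1 (hφ h))).symm
  refine eq_of_forall_dual_eq fun f => ?_
  -- Continuity of `S` is known only on `[0, ∞)`; freezing the argument at `0` gives a continuous
  -- function on the whole line.
  set k : ℝ → ℂ := fun s => f (S (max s 0) y) with hk
  have hkc : Continuous k := f.continuous.comp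
    ((hS.continuousOn y).comp_continuous (by fun_prop) fun s => le_max_right s 0)
  have hfx : ∀ t, 0 < t → f (S t x) = (gKer (α + 1) t : ℂ) * f (C x) + ∫ s in (0 : ℝ)..t, k s := by
    intro t ht
    have h1 := (hxy t ht.le f).2
    rw [map_sub, map_smul, smul_eq_mul] at h1
    rw [intervalIntegral.integral_of_le ht.le,
      setIntegral_congr_fun (g := fun s => f (S s y)) measurableSet_Ioc fun s hs => by
        simp only [hk, max_eq_left hs.1.le], h1]
    ring
  have hd : ContDiff ℝ ∞ (deriv φ) := by simpa using contDiff_iteratedDeriv φ.contDiff 1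
  obtain ⟨R, hR, hR'⟩ := exists_pos_forall_lt_eq_zero φ.hasCompactSupport.deriv
  have hKc : Continuous fun t => ∫ s in (0 : ℝ)..t, k s :=
    intervalIntegral.continuous_primitive (fun a b => hkc.intervalIntegrable a b) 0
  have hgc : ContinuousOn (fun t => (gKer (α + 1) t : ℂ)) (Ici 0) := by
    refine Complex.continuous_ofReal.comp_continuousOn (ContinuousOn.div_const ?_ _)
    exact continuousOn_id.rpow_const fun t _ => Or.inr (by linarith)
  have hint : ∀ {h : ℝ → ℂ}, ContinuousOn h (Ici 0) →
      IntegrableOn (fun t => weylDeriv α (deriv φ) t * h t) (Ioi 0) := fun hh =>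
    integrableOn_mul_of_eq_zero (continuous_weylDeriv α hd φ.hasCompactSupport.deriv) hR.le
      (fun t ht => weylDeriv_eq_zero α hd φ.hasCompactSupport.deriv hR' ht) hh
  have h1 : f (G (∂_{(1 : ℝ)} φ) x) = -f (G φ y) := by
    rw [← (hG _ x f).2, ← (hG φ y f).2, lineDeriv_testFn]
    simp only [map_smul, smul_eq_mul]
    have h2 : ∀ t ∈ Ioi (0 : ℝ), weylDeriv α (deriv φ) t * f (S t x) =
        weylDeriv α (deriv φ) t * (gKer (α + 1) t : ℂ) * f (C x) +
          weylDeriv α (deriv φ) t * ∫ s in (0 : ℝ)..t, k s := by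
      intro t ht
      rw [hfx t ht]
      ring
    rw [setIntegral_congr_fun measurableSet_Ioi h2,
      integral_add ((hint hgc).mul_const _) (hint hKc.continuousOn), integral_mul_const,
      integral_weylDeriv_deriv_mul_gKer hα hφ0, zero_mul, zero_add,
      integral_weylDeriv_deriv_mul_primitive hkc]
    congr 1
    refine setIntegral_congr_fun measurableSet_Ioi fun t ht => ?_
    simp only [hk, max_eq_left (le_of_lt (mem_Ioi.1 ht))]
  rw [map_neg, _root_.neg_apply, map_neg, h1, neg_neg]

end Main

end CDS

end

/-! ### Assembly of the theorem. -/

theorem theorem4p8 {E : Type*} [AddCommGroup E] [Module ℂ E] [UniformSpace E]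
    [IsUniformAddGroup E] [ContinuousSMul ℂ E] [LocallyConvexSpace ℝ E] [T2Space E]
    [BarrelledSpace ℂ E]
    (hE : ∀ u : ℕ → E, CauchySeq u → ∃ x : E, Tendsto u atTop (𝓝 x))
    (C : E →L[ℂ] E) (α : ℝ) (hα : 0 ≤ α)
    (S : ℝ → E →L[ℂ] E) (hS : CDS.IsIntegratedSemigroup α C S)
    (hexp : CDS.IsExpEquicontinuous S)
    (A : Submodule ℂ (E × E)) (hA : A = CDS.integralGenerator α C S) :
    ∃ G : CDS.TestFn →L[ℂ] (E →L[ℂ] E),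
      (∀ (φ : CDS.TestFn) (x : E),
        CDS.HasIntegral (fun t => CDS.weylDeriv α φ t • S t x) (volume.restrict (Ioi 0)) (G φ x)) ∧
      CDS.IsPreCEDS C G ∧
      A ≤ CDS.generator G := by
  subst hA
  have := CDS.polynormableSpace_of_locallyConvexSpace (E := E)
  obtain ⟨w₀, hw₀, hq⟩ := hexp.exists_seminorm
  obtain ⟨J, hJ⟩ := CDS.exists_integralOperator hE hS.continuousOn hw₀ hq (CDS.ceil_sub_nonneg α)
  have hG : ∀ (φ : CDS.TestFn) (x : E),
      CDS.HasIntegral (fun t => CDS.weylDeriv α φ t • S t x) (volume.restrict (Ioi 0))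
        (((-1 : ℂ) ^ ⌈α⌉₊ • J.comp (CDS.testTwist (w₀ + 1) ⌈α⌉₊)) φ x) := by
    intro φ x
    have h := (hJ (CDS.testTwist (w₀ + 1) ⌈α⌉₊ φ) x).smul ((-1 : ℂ) ^ ⌈α⌉₊)
    simp only [← mul_smul, ← CDS.weylDeriv_eq_expWeylInt] at h
    exact h
  -- The tempered extension uses the same operator `J`, with `testTwist` replaced by
  -- `schwartzTwist`; the two agree after the exponential twist.
  refine ⟨_, hG, ⟨CDS.isPreCDS_of_hasIntegral hα hS hG, w₀ + 1,
    (-1 : ℂ) ^ ⌈α⌉₊ • J.comp (CDS.schwartzTwist (w₀ + 1) ⌈α⌉₊), fun φ => ?_⟩,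
    CDS.integralGenerator_le_generator hα hS hG⟩
  change (-1 : ℂ) ^ ⌈α⌉₊ • J (CDS.schwartzTwist (w₀ + 1) ⌈α⌉₊ (CDS.toSchwartz φ)) = _
  rw [CDS.schwartzTwist_toSchwartz]
  rfl
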